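/- **Setting.** Fix $a>0$, $T>0$, $L>0$ and let $\mathcal T=\{\rho=(\rho_1,\rho_2)\in\mathbb R^2: -a\le\rho_1<\rho_2\le a\}$, with Lebesgue measure $d\rho$. For $\rho_1<\rho_2$ let $\mathcal L_\rho=\{(u,1):u>\rho_1\}\cup\{(u,-1):u<\rho_2\}$. For a continuous input $v$ on $[0,T]$ and $z^0\in\{-1,1\}$ with $(v(0),z^0)\in\mathcal L_\rho$, the relay output $h^\rho(v,z^0)(t)$ is $1$ if, among the times in $[0,t]$ at which $v\ge\rho_2$ or $v\le\rho_1$, the last one has $v\ge\rho_2$; it is $-1$ if the last one has $v\le\rho_1$; and it is $z^0$ if there is no such time. Let $z_v(\rho)=-1$ if $\rho_2>-\rho_1$ and $z_v(\rho)=1$ if $\rho_2<-\rho_1$. Let $\tilde{\mathcal S}$ be the set of functions $z:\mathcal T\to\{-1,1\}$, identified up to null sets, of the form $z(\rho)=h^\rho(v,z_v(\rho))(T)$ with $v\in C^0([0,T])$ such that $(v(0),z_v(\rho))\in\mathcal L_\rho$ for all $\rho_1<\rho_2$ (off the antidiagonal $\rho_2=-\rho_1$, where the value of $z_v$ is immaterial;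 this means $v(0)=0$), and let $\tilde{\mathcal S}_L$ be the subset given by $L$-Lipschitz inputs $v$. Put $d(z,z')=\int_{\mathcal T}|z-z'|\,d\rho$. $L^1(\mathbb R;\tilde{\mathcal S}_L)$ is the set of (measurable) $z:\mathbb R\to\tilde{\mathcal S}_L$ with $\int_{\mathbb R}d(z(x),z_v)\,dx<\infty$, and $BV(\mathbb R;\tilde{\mathcal S}_L)$ is the set of $z:\mathbb R\to\tilde{\mathcal S}_L$ that agree almost everywhere with a map of bounded variation with respect to $d$. Consider the Cauchy problem $u_t+w_t+u_x=0$ in $\mathbb R\times[0,T)$, $u(x,0)=u_0(x)$, where $w$ is the output of the Preisach operator with input $u$ and initial state $z_0$. An *entropy solution* with initial data $(u_0,z_0)$ is a pair $(u,w)$ with $w(x,t)=\int_{\mathcal T}z(x,t;\rho)\,d\rho$ a.e., where $u$ is integrable on $[-R,R]\times(0,T)$ for every $R$, $z$ is measurable, $z(x,t)\in\tilde{\mathcal S}$ for a.e. $(x,t)\in\mathbb R\times(0,T)$, and: 1. for a.e. $(x,t)$ and a.e. $\rho\in\mathcal T$: $|z|=1$, $(z-1)(u-\rho_2)\ge0$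 and $(z+1)(u-\rho_1)\ge0$; 2. for every $k\in\mathbb R$, every $\hat z\in\tilde{\mathcal S}$ with $(k,\hat z(\rho))\in\mathcal L_\rho$ for a.e. $\rho\in\mathcal T$, and every nonnegative $\phi\in C^\infty$ with compact support in $\mathbb R\times(0,+\infty)$, $$\int_{\mathbb R}\int_0^T\Big[|u-k|+\int_{\mathcal T}|z-\hat z|\,d\rho\Big]\phi_t+|u-k|\,\phi_x\;dt\,dx\ \ge\ 0;$$ 3. the initial data are attained: for every $R>0$, $\displaystyle\operatorname*{ess\,lim}_{t\to0+}\int_{-R}^R\Big(|u(x,t)-u_0(x)|+d(z(x,t),z_0(x))\Big)dx=0$. **Theorem ($L^1$-contraction and uniqueness).** For $i=1,2$ let $u_0^i\in L^1(\mathbb R)\cap BV(\mathbb R)$ and $z_0^i\in L^1(\mathbb R;\tilde{\mathcal S}_L)\cap BV(\mathbb R;\tilde{\mathcal S}_L)$, and let $(u_i,w_i)$, $w_i=\int_{\mathcal T}z_i\,d\rho$, be an entropy solution with initial data $(u_0^i,z_0^i)$. Then for almost every $t\in[0,T]$ $$\int_{\mathbb R}\Big(|u_1-u_2|(x,t)+\int_{\mathcal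 T}|z_1-z_2|(x,t;\rho)\,d\rho\Big)dx\ \le\ \int_{\mathbb R}\Big(|u_0^1-u_0^2|(x)+\int_{\mathcal T}|z_0^1-z_0^2|(x;\rho)\,d\rho\Big)dx,$$ both integrands being integrable. In particular the entropy solution is unique: if $u_0^1=u_0^2$ a.e. in $\mathbb R$ and $z_0^1=z_0^2$ a.e. in $\mathbb R\times\mathcal T$, then $u_1=u_2$ and $w_1=w_2$ a.e. in $\mathbb R\times(0,T)$, and $z_1=z_2$ a.e. in $\mathbb R\times(0,T)\times\mathcal T$. -/

import Mathlib

open MeasureTheory Set Filter Topology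
open scoped NNReal ContDiff

noncomputable section

namespace Preisach

/-- The Preisach half plane of pairs of thresholds `ρ = (ρ₁, ρ₂)` with `ρ₁ < ρ₂`. -/
def plane : Set (ℝ × ℝ) := {ρ | ρ.1 < ρ.2}

/-- The triangle in the Preisach plane with vertices `(-a,-a)`, `(a,a)`, `(-a,a)`. -/
def triangle (a : ℝ) : Set (ℝ × ℝ) := {ρ | ρ ∈ plane ∧ -a ≤ ρ.1 ∧ ρ.2 ≤ a}

/-- The hysteresis region `{(u, 1) : u > ρ₁} ∪ {(u, -1) : u < ρ₂}` of the relay with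
thresholds `ρ`. -/
def relayRegion (ρ : ℝ × ℝ) : Set (ℝ × ℝ) :=
  {p | (ρ.1 < p.1 ∧ p.2 = 1) ∨ (p.1 < ρ.2 ∧ p.2 = -1)}

open Classical in
/-- The output at time `t` of the (delayed) relay with thresholds `ρ`, continuous input `u` on
`[0, t]` and initial state `z₀`, where `(u 0, z₀)` lies in the hysteresis region. It is `1` if,
at some time `s ≤ t`, the input was at or above the upper threshold and has stayed strictly
above the lower threshold since then; it is `-1` if, at some time `s ≤ t`, the input was at or
below the lower threshold and has stayed strictly below the upper threshold since then; and it
is still `z₀` if neither threshold has been reached. The first two cases exclude each other. -/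
def relay (ρ : ℝ × ℝ) (u : ℝ → ℝ) (z₀ : ℝ) (t : ℝ) : ℝ :=
  if ∃ s ∈ Icc 0 t, ρ.2 ≤ u s ∧ ∀ r ∈ Icc s t, ρ.1 < u r then 1
  else if ∃ s ∈ Icc 0 t, u s ≤ ρ.1 ∧ ∀ r ∈ Icc s t, u r < ρ.2 then -1
  else z₀

/-- The virgin state: `-1` above the antidiagonal `ρ₂ = -ρ₁` and `1` below it. The value on the
antidiagonal, a null set, is immaterial. -/
def virgin (ρ : ℝ × ℝ) : ℝ := if -ρ.1 ≤ ρ.2 then -1 else 1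

/-- `z` is (on the triangle, up to null sets) the final state of the family of relays that starts
from the virgin state and is driven by the input `u` on `[0, T]`. The initial value `u 0` has to
be compatible with the virgin state. -/
def GeneratedBy (a T : ℝ) (u : ℝ → ℝ) (z : ℝ × ℝ → ℝ) : Prop :=
  (∀ ρ ∈ plane, (u 0, virgin ρ) ∈ relayRegion ρ) ∧
  ∀ᵐ ρ ∂volume.restrict (triangle a), z ρ = relay ρ u (virgin ρ) T

/-- The configurations generated from the virgin state by continuous inputs on `[0, T]`. -/
def configurations (a T : ℝ) : Set (ℝ × ℝ → ℝ) :=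
  {z | ∃ u : ℝ → ℝ, ContinuousOn u (Icc 0 T) ∧ GeneratedBy a T u z}

/-- The configurations generated from the virgin state by `L`-Lipschitz inputs on `[0, T]`. -/
def lipschitzConfigurations (a T : ℝ) (L : ℝ≥0) : Set (ℝ × ℝ → ℝ) :=
  {z | ∃ u : ℝ → ℝ, LipschitzOnWith L u (Icc 0 T) ∧ GeneratedBy a T u z}

/-- The distance `d(z₁, z₂) = ∫_𝒯 |z₁ - z₂| dρ` of two configurations, the integral being over
the triangle. -/
def configDist (a : ℝ) (z₁ z₂ : ℝ × ℝ → ℝ) : ℝ :=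
  ∫ ρ in triangle a, |z₁ ρ - z₂ ρ|

/-- Maps in `L¹(ℝ; E)`, where `E` is the space of the configurations generated by `L`-Lipschitz
inputs, with the virgin state as its zero point. -/
structure IsL1Config (a T : ℝ) (L : ℝ≥0) (z : ℝ → ℝ × ℝ → ℝ) : Prop where
  aemeasurable : AEMeasurable (fun p : ℝ × (ℝ × ℝ) => z p.1 p.2)
    (volume.restrict (univ ×ˢ triangle a))
  mem : ∀ᵐ x : ℝ, z x ∈ lipschitzConfigurations a T L
  integrable : Integrable (fun x : ℝ => configDist a (z x) virgin)

/-- Maps in `BV(ℝ; E)`, where `E` is the space of the configurations generated by `L`-Lipschitz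
inputs: some representative has bounded variation with respect to `configDist`. -/
def IsBVConfig (a T : ℝ) (L : ℝ≥0) (z : ℝ → ℝ × ℝ → ℝ) : Prop :=
  ∃ v : ℝ → ℝ × ℝ → ℝ,
    (∀ x, v x ∈ lipschitzConfigurations a T L) ∧
    (∀ᵐ x : ℝ, configDist a (z x) (v x) = 0) ∧
    ∃ C : ℝ, ∀ (n : ℕ) (x : ℕ → ℝ), Monotone x →
      ∑ i ∈ Finset.range n, configDist a (v (x i)) (v (x (i + 1))) ≤ C

/-- Real functions in `L¹(ℝ) ∩ BV(ℝ)`. -/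
def IsL1BV (u : ℝ → ℝ) : Prop :=
  Integrable u ∧ ∃ v : ℝ → ℝ, u =ᵐ[volume] v ∧ BoundedVariationOn v univ

/-- The entropy condition on `ℝ × (0, T)` for the pair `(u, z)`. A point of `ℝ × ℝ` is `(x, t)`;
`fderiv ℝ φ p (0, 1)` is `∂φ/∂t` and `fderiv ℝ φ p (1, 0)` is `∂φ/∂x`. -/
def EntropyCondition (a T : ℝ) (u : ℝ → ℝ → ℝ) (z : ℝ → ℝ → ℝ × ℝ → ℝ) : Prop :=
  ∀ (k : ℝ) (zhat : ℝ × ℝ → ℝ), zhat ∈ configurations a T →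
    (∀ᵐ ρ ∂volume.restrict (triangle a), (k, zhat ρ) ∈ relayRegion ρ) →
    ∀ φ : ℝ × ℝ → ℝ, ContDiff ℝ ∞ φ → HasCompactSupport φ →
      tsupport φ ⊆ univ ×ˢ Ioi 0 → (∀ p, 0 ≤ φ p) →
      0 ≤ ∫ p in (univ : Set ℝ) ×ˢ Ioo 0 T,
        ((|u p.1 p.2 - k| + configDist a (z p.1 p.2) zhat) * fderiv ℝ φ p (0, 1)
          + |u p.1 p.2 - k| * fderiv ℝ φ p (1, 0))

/-- `(u, w)`, with `w = ∫_𝒯 z dρ`, is an entropy solution on `ℝ × [0, T)` of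
`u_t + w_t + u_x = 0`, where `w` is the output of the Preisach operator with input `u` and
initial state `z₀`, and of `u(·, 0) = u₀`. -/
structure IsEntropySolution (a T : ℝ) (u₀ : ℝ → ℝ) (z₀ : ℝ → ℝ × ℝ → ℝ)
    (u w : ℝ → ℝ → ℝ) (z : ℝ → ℝ → ℝ × ℝ → ℝ) : Prop where
  integrableOn : ∀ R : ℝ,
    IntegrableOn (fun p : ℝ × ℝ => u p.1 p.2) (Icc (-R) R ×ˢ Ioo 0 T)
  aemeasurable : AEMeasurable (fun p : ℝ × ℝ × (ℝ × ℝ) => z p.1 p.2.1 p.2.2)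
    (volume.restrict (univ ×ˢ Ioo 0 T ×ˢ triangle a))
  /-- the states of the relays form a configuration -/
  mem : ∀ᵐ p : ℝ × ℝ ∂volume.restrict (univ ×ˢ Ioo 0 T), z p.1 p.2 ∈ configurations a T
  /-- the states of the relays are compatible with the value of `u` -/
  compatible : ∀ᵐ p : ℝ × ℝ ∂volume.restrict (univ ×ˢ Ioo 0 T),
    ∀ᵐ ρ ∂volume.restrict (triangle a), |z p.1 p.2 ρ| = 1 ∧
      0 ≤ (z p.1 p.2 ρ - 1) * (u p.1 p.2 - ρ.2) ∧
      0 ≤ (z p.1 p.2 ρ + 1) * (u p.1 p.2 - ρ.1)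
  output : ∀ᵐ p : ℝ × ℝ ∂volume.restrict (univ ×ˢ Ioo 0 T),
    w p.1 p.2 = ∫ ρ in triangle a, z p.1 p.2 ρ
  entropy : EntropyCondition a T u z
  /-- the initial data are attained in `L¹_loc`, as an essential limit for `t → 0+` -/
  initial : ∀ R : ℝ, Tendsto
    (fun t : ℝ => ∫ x in Icc (-R) R, (|u x t - u₀ x| + configDist a (z x t) (z₀ x)))
    (𝓝[>] 0 ⊓ ae volume) (𝓝 0)

end Preisach

end

/-!
The proof is Kružkov's doubling of variables. By the compatibility of inputs and relays, for almost
every `q` in the strip the value `(u₂, z₂)(q)` of the second solution is an admissible constant in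
the entropy condition of the first one, and conversely; the closed constraints of a solution differ
from the hysteresis region only for thresholds `ρ` with `ρ₁ = u` or `ρ₂ = u`, a null set
(`IsEntropySolution.ae_mem_relayRegion`). With the vector field
`A p q = (|u₁ p - u₂ q|, |u₁ p - u₂ q| + d(z₁ p, z₂ q))` both conditions have the form
`0 ≤ ∫ fderiv φ (A p q)`, in `p` and in `q`. They are applied to `ψ p * δ (p - q)`, where `δ` is a
smooth bump of small support. In the sum the derivatives of `δ` cancel, and as the support of `δ`
shrinks there remains `0 ≤ ∫ fderiv ψ p (A p p) dp` (`doubling_of_variables`,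
`IsEntropySolution.kruzkov`). The limit needs only that `∫_K ‖A p (p - h) - A p p‖ dp → 0` as
`h → 0`, which is continuity of translations in `L¹` on space-time for `u₂`, and on the product of
space-time with the Preisach plane for `z₂` (`tendsto_entropyField_translate`).

On the diagonal the flux `F = |u₁ - u₂|` and the density `E = F + d(z₁, z₂)` satisfy `0 ≤ F ≤ E`:
signals travel at speeds between `0` and `1`. A cutoff that is nonincreasing along all directions
`(f, e)` with `0 ≤ f ≤ e` therefore turns the inequality into the statement that the mass
of `E` inside the cutoff has a nonpositive distributional time derivative, hence is nonincreasing on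
a set of times of full measure (`ae_antitone_of_forall_isTest`, `ae_antitone_integral_coneCutoff`).
By the initial condition this mass is at most the total initial mass
(`integral_coneCutoff_le_initial`), and letting the cutoff grow gives integrability and contraction
on the whole line. Uniqueness is the case of initial mass zero.

Measurability is dealt with once: each solution is replaced by an everywhere measurable
representative whose relay states are bounded by `1` everywhere (`IsRegularPair`).
-/

namespace Preisach

/-! ### Continuity of translations in `L¹` -/

section Translation

variable {G : Type*} [NormedAddCommGroup G] [NormedSpace ℝ G] [FiniteDimensional ℝ G]
  [MeasurableSpace G] [BorelSpace G] {μ : Measure G} [μ.IsAddHaarMeasure]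

theorem tendsto_lintegral_translate_sub {v : G → ℝ} (hv : Integrable v μ) :
    Tendsto (fun h : G => ∫⁻ x, ‖v (x - h) - v x‖ₑ ∂μ) (𝓝 0) (𝓝 0) := by
  have : Fact ((1 : ENNReal) ≠ ⊤) := ⟨ENNReal.one_ne_top⟩
  have hc : Continuous fun h : G => DomAddAct.mk (-h) +ᵥ hv.toL1 :=
    (DomAddAct.continuous_mk.comp continuous_neg).vadd continuous_const
  have h0 := (hc.edist (continuous_const (y := hv.toL1))).tendsto 0
  have e0 : edist (DomAddAct.mk (-(0 : G)) +ᵥ hv.toL1) hv.toL1 = 0 := by simp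
  rw [e0] at h0
  refine h0.congr fun h => ?_
  have hmp : MeasurePreserving (fun x : G => -h +ᵥ x) μ μ := by
    simpa using measurePreserving_vadd (-h) μ
  have e1 : DomAddAct.mk (-h) +ᵥ hv.toL1 = (hmp.integrable_comp_of_integrable hv).toL1 := by
    rw [Integrable.toL1, Integrable.toL1, DomAddAct.mk_vadd_toLp]; rfl
  rw [e1, Integrable.edist_toL1_toL1]
  refine lintegral_congr fun x => ?_
  simp [edist_eq_enorm_sub, sub_eq_neg_add]

theorem tendsto_setLIntegral_translate_sub {v : G → ℝ} (hv : LocallyIntegrable v μ)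
    {K : Set G} (hK : IsCompact K) :
    Tendsto (fun h : G => ∫⁻ x in K, ‖v (x - h) - v x‖ₑ ∂μ) (𝓝 0) (𝓝 0) := by
  have hK' : IsCompact (Metric.cthickening 1 K) := hK.cthickening
  have hm : MeasurableSet (Metric.cthickening 1 K) := Metric.isClosed_cthickening.measurableSet
  have hi := tendsto_lintegral_translate_sub (μ := μ)
    (((integrable_indicator_iff hm).2 (hv.integrableOn_isCompact hK')))
  refine tendsto_of_tendsto_of_tendsto_of_le_of_le' tendsto_const_nhds hi
    (Eventually.of_forall fun _ => zero_le) ?_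
  filter_upwards [Metric.closedBall_mem_nhds (0 : G) one_pos] with h hh
  rw [mem_closedBall_zero_iff] at hh
  refine (setLIntegral_mono_ae' hK.measurableSet (ae_of_all _ fun x hx => ?_)).trans
    (setLIntegral_le_lintegral K _)
  have h1 : x ∈ Metric.cthickening 1 K := Metric.self_subset_cthickening K hx
  have h2 : x - h ∈ Metric.cthickening 1 K := by
    refine Metric.mem_cthickening_of_dist_le _ x _ _ hx ?_
    simpa [dist_eq_norm] using hh
  rw [indicator_of_mem h1, indicator_of_mem h2]

end Translation

/-! ### Doubling of variables -/

/-- The nonnegative test functions on an open set `Ω`: smooth, with compact support in `Ω`. -/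
structure IsTest {V : Type*} [NormedAddCommGroup V] [NormedSpace ℝ V] (Ω : Set V) (φ : V → ℝ) :
    Prop where
  contDiff : ContDiff ℝ ∞ φ
  compact : HasCompactSupport φ
  subset : tsupport φ ⊆ Ω
  nonneg : ∀ p, 0 ≤ φ p

section Doubling

variable {V : Type*} [NormedAddCommGroup V] [NormedSpace ℝ V]

/-- A continuous field of functionals with compact support is integrable along a locally
integrable vector field. -/
theorem integrable_apply_of_hasCompactSupport {X : Type*} [TopologicalSpace X]
    [MeasurableSpace X] [OpensMeasurableSpace X] {ν : Measure X}
    {g : X → V →L[ℝ] ℝ} (hg : Continuous g) (hgc : HasCompactSupport g) {A : X → V}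
    (hA : LocallyIntegrable A ν) [SecondCountableTopologyEither X (V →L[ℝ] ℝ)] :
    Integrable (fun x => g x (A x)) ν := by
  have hK := hgc.isCompact
  obtain ⟨C, hC⟩ := hgc.exists_bound_of_continuous hg
  have h1 : IntegrableOn (fun x => g x (A x)) (tsupport g) ν := by
    have h2 := hA.integrableOn_isCompact hK
    have := ContinuousLinearMap.integrable_of_bilin_of_bdd_left
      (ContinuousLinearMap.id ℝ (V →L[ℝ] ℝ)) C hg.aestronglyMeasurable (ae_of_all _ hC) h2
    exact this
  refine (integrableOn_iff_integrable_of_support_subset fun x hx => ?_).1 h1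
  refine subset_tsupport g ?_
  rw [Function.mem_support] at hx ⊢
  rintro h
  simp [h] at hx

variable [FiniteDimensional ℝ V]
  [MeasurableSpace V] [BorelSpace V] {μ : Measure V} [μ.IsAddHaarMeasure]

theorem locallyIntegrable_prod_of_norm_le {A : V × V → V} (hA : Measurable A) {n₁ n₂ : V → ℝ}
    (hn₁ : LocallyIntegrable n₁ μ) (hn₂ : LocallyIntegrable n₂ μ)
    (h : ∀ x, ‖A x‖ ≤ n₁ x.1 + n₂ x.2) : LocallyIntegrable A (μ.prod μ) := by
  rw [locallyIntegrable_iff]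
  intro K hK
  have h1 := hK.image continuous_fst
  have h2 := hK.image continuous_snd
  have : IsFiniteMeasure (μ.restrict (Prod.fst '' K)) := ⟨by simpa using h1.measure_lt_top⟩
  have : IsFiniteMeasure (μ.restrict (Prod.snd '' K)) := ⟨by simpa using h2.measure_lt_top⟩
  have hi : IntegrableOn A ((Prod.fst '' K) ×ˢ (Prod.snd '' K)) (μ.prod μ) := by
    rw [IntegrableOn, ← Measure.prod_restrict]
    exact (((hn₁.integrableOn_isCompact h1).comp_fst _).add
      ((hn₂.integrableOn_isCompact h2).comp_snd _)).mono' hA.aestronglyMeasurable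
      (ae_of_all _ h)
  exact hi.mono_set fun x hx => ⟨mem_image_of_mem _ hx, mem_image_of_mem _ hx⟩

/-- Kružkov's doubling of variables for a vector field `A p q`. If the distributional divergence
of `A` is nonpositive in `p` for almost every `q` and in `q` for almost every `p`, then the
divergence of the diagonal `p ↦ A p p` is nonpositive, provided that `A` depends on `q`
continuously in the mean (`htr`). -/
theorem doubling_of_variables {A : V → V → V} (hA : Measurable (Function.uncurry A))
    {n₁ n₂ : V → ℝ} (hn₁ : LocallyIntegrable n₁ μ) (hn₂ : LocallyIntegrable n₂ μ)
    (hn : ∀ p q, ‖A p q‖ ≤ n₁ p + n₂ q)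
    (htr : ∀ K : Set V, IsCompact K →
      Tendsto (fun h => ∫⁻ p in K, ‖A p (p - h) - A p p‖ₑ ∂μ) (𝓝 0) (𝓝 0))
    {Ω : Set V} (hΩ : IsOpen Ω)
    (h₁ : ∀ᵐ q ∂μ, q ∈ Ω → ∀ φ, IsTest Ω φ → 0 ≤ ∫ p, fderiv ℝ φ p (A p q) ∂μ)
    (h₂ : ∀ᵐ p ∂μ, p ∈ Ω → ∀ φ, IsTest Ω φ → 0 ≤ ∫ q, fderiv ℝ φ q (A p q) ∂μ)
    {ψ : V → ℝ} (hψ : IsTest Ω ψ) : 0 ≤ ∫ p, fderiv ℝ ψ p (A p p) ∂μ := by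
  set K := tsupport ψ with hKdef
  have hK : IsCompact K := hψ.compact
  obtain ⟨ε₀, hε₀, hKΩ⟩ := hK.exists_cthickening_subset_open hΩ hψ.subset
  have hψ' : Continuous (fderiv ℝ ψ) := hψ.contDiff.continuous_fderiv (by simp)
  obtain ⟨C, hC⟩ := (hψ.compact.fderiv ℝ).exists_bound_of_continuous hψ'
  have hAd : Measurable fun p => A p p := hA.comp (measurable_id.prodMk measurable_id)
  have hAdi : LocallyIntegrable (fun p => A p p) μ :=
    (hn₁.add hn₂).mono hAd.aestronglyMeasurable
      (ae_of_all _ fun p => (hn p p).trans (le_abs_self _))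
  have hDi : Integrable (fun p => fderiv ℝ ψ p (A p p)) μ :=
    integrable_apply_of_hasCompactSupport hψ' (hψ.compact.fderiv ℝ) hAdi
  have hAi := locallyIntegrable_prod_of_norm_le (μ := μ) hA hn₁ hn₂ fun x => hn x.1 x.2
  -- it suffices to bound the integral below by `-η` for every `η > 0`
  have hC0 : 0 ≤ C := (norm_nonneg _).trans (hC 0)
  suffices H : ∀ η : ℝ≥0, 0 < η → -(C * η) ≤ ∫ p, fderiv ℝ ψ p (A p p) ∂μ by
    have : Tendsto (fun η : ℝ≥0 => -(C * (η : ℝ))) (𝓝[>] 0) (𝓝 0) := by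
      have hc : Continuous fun η : ℝ≥0 => -(C * (η : ℝ)) := by fun_prop
      simpa using (hc.tendsto 0).mono_left nhdsWithin_le_nhds
    exact le_of_tendsto this (eventually_nhdsWithin_of_forall fun η hη => H η hη)
  intro η hη
  obtain ⟨ε₁, hε₁, hsmall⟩ := Metric.eventually_nhds_iff.1
    ((htr K hK).eventually_le_const (u := (η : ENNReal)) (by simpa using hη))
  have hεpos : 0 < min ε₀ (ε₁ / 2) := by positivity
  let b : ContDiffBump (0 : V) := ⟨min ε₀ (ε₁ / 2) / 2, min ε₀ (ε₁ / 2), by positivity, by linarith⟩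
  have hb : b.rOut = min ε₀ (ε₁ / 2) := rfl
  set δ := b.normed μ with hδ
  have hδs : ContDiff ℝ ∞ δ := b.contDiff_normed
  have hδ' : Continuous (fderiv ℝ δ) := hδs.continuous_fderiv (by simp)
  have hδ0 : ∀ h, 0 ≤ δ h := fun h => b.nonneg_normed h
  have hδsupp : ∀ h, ε₀ < ‖h‖ ∨ ε₁ ≤ ‖h‖ → h ∉ tsupport δ := by
    intro h hh hmem
    rw [hδ, b.tsupport_normed_eq, mem_closedBall_zero_iff, hb] at hmem
    have := min_le_left ε₀ (ε₁ / 2)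
    have := min_le_right ε₀ (ε₁ / 2)
    rcases hh with h1 | h1 <;> linarith
  have hnear : ∀ p q, p ∈ K → q ∉ Metric.cthickening ε₀ K → p - q ∉ tsupport δ := by
    intro p q hp hq
    refine hδsupp _ (Or.inl ?_)
    by_contra hle
    exact hq (Metric.mem_cthickening_of_dist_le q p _ _ hp (by
      rw [dist_comm, dist_eq_norm]; exact not_lt.1 hle))
  have hψK : ∀ p, p ∉ K → ψ p = 0 := fun p hp => image_eq_zero_of_notMem_tsupport hp
  have hψK' : ∀ p, p ∉ K → fderiv ℝ ψ p = 0 := fun p hp =>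
    image_eq_zero_of_notMem_tsupport fun h => hp (tsupport_fderiv_subset ℝ h)
  have hδz : ∀ h, h ∉ tsupport δ → δ h = 0 := fun p hp => image_eq_zero_of_notMem_tsupport hp
  have hδz' : ∀ h, h ∉ tsupport δ → fderiv ℝ δ h = 0 := fun p hp =>
    image_eq_zero_of_notMem_tsupport fun h => hp (tsupport_fderiv_subset ℝ h)
  -- the two parts of the derivative of `ψ p * δ (p - q)` with respect to `p`
  let gX : V × V → V →L[ℝ] ℝ := fun x => δ (x.1 - x.2) • fderiv ℝ ψ x.1
  let gY : V × V → V →L[ℝ] ℝ := fun x => ψ x.1 • fderiv ℝ δ (x.1 - x.2)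
  have hsub : Continuous fun x : V × V => x.1 - x.2 := continuous_fst.sub continuous_snd
  have hgX : Continuous gX :=
    (hδs.continuous.comp hsub).smul (hψ'.comp continuous_fst)
  have hgY : Continuous gY :=
    (hψ.contDiff.continuous.comp continuous_fst).smul (hδ'.comp hsub)
  have hKK : IsCompact (K ×ˢ Metric.cthickening ε₀ K) := hK.prod hK.cthickening
  have hcX : HasCompactSupport gX := by
    refine HasCompactSupport.intro hKK fun x hx => ?_
    by_cases h1 : x.1 ∈ K
    · simp [gX, hδz _ (hnear _ _ h1 fun h => hx ⟨h1, h⟩)]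
    · simp [gX, hψK' _ h1]
  have hcY : HasCompactSupport gY := by
    refine HasCompactSupport.intro hKK fun x hx => ?_
    by_cases h1 : x.1 ∈ K
    · simp [gY, hδz' _ (hnear _ _ h1 fun h => hx ⟨h1, h⟩)]
    · simp [gY, hψK _ h1]
  have hXi : Integrable (fun x : V × V => gX x (A x.1 x.2)) (μ.prod μ) :=
    integrable_apply_of_hasCompactSupport hgX hcX hAi
  have hYi : Integrable (fun x : V × V => gY x (A x.1 x.2)) (μ.prod μ) :=
    integrable_apply_of_hasCompactSupport hgY hcY hAi
  have hψd : Differentiable ℝ ψ := hψ.contDiff.differentiable (by simp)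
  have hδd : Differentiable ℝ δ := hδs.differentiable (by simp)
  -- inequality in the first variable
  have hXY : 0 ≤ ∫ x, (gX x (A x.1 x.2) + gY x (A x.1 x.2)) ∂μ.prod μ := by
    refine le_of_le_of_eq ?_ (integral_prod_symm _ (hXi.add hYi)).symm
    refine integral_nonneg_of_ae ?_
    filter_upwards [h₁] with q hq
    by_cases hqK : q ∈ Metric.cthickening ε₀ K
    · have htest : IsTest Ω fun p => ψ p * δ (p - q) :=
        { contDiff := hψ.contDiff.mul (hδs.comp (contDiff_id.sub contDiff_const))
          compact := hψ.compact.mul_right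
          subset := (tsupport_mul_subset_left).trans hψ.subset
          nonneg := fun p => mul_nonneg (hψ.nonneg p) (hδ0 _) }
      refine (hq (hKΩ hqK) _ htest).trans_eq (integral_congr_ae (ae_of_all _ fun p => ?_))
      have e := fderiv_fun_mul (𝕜 := ℝ) (hψd p) ((differentiableAt_comp_sub q).2 (hδd (p - q)))
      simp only [e, fderiv_comp_sub]
      simp [gX, gY, add_comm]
    · refine (integral_nonneg fun p => ?_)
      by_cases h1 : p ∈ K
      · simp [gX, gY, hδz _ (hnear _ _ h1 hqK), hδz' _ (hnear _ _ h1 hqK)]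
      · simp [gX, gY, hψK _ h1, hψK' _ h1]
  -- inequality in the second variable
  have hY : ∫ x, gY x (A x.1 x.2) ∂μ.prod μ ≤ 0 := by
    rw [integral_prod _ hYi]
    refine integral_nonpos_of_ae ?_
    filter_upwards [h₂] with p hp
    by_cases h1 : p ∈ K
    · have hsupp : tsupport (fun q => δ (p - q)) ⊆ Metric.cthickening ε₀ K := by
        refine closure_minimal (fun q hq => ?_) Metric.isClosed_cthickening
        by_contra hqK
        exact hq (hδz _ (hnear _ _ h1 hqK))
      have htest : IsTest Ω fun q => δ (p - q) :=
        { contDiff := hδs.comp (contDiff_const.sub contDiff_id)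
          compact := hK.cthickening.of_isClosed_subset (isClosed_tsupport _) hsupp
          subset := hsupp.trans hKΩ
          nonneg := fun q => hδ0 _ }
      have hfd : ∀ q, fderiv ℝ (fun q => δ (p - q)) q = -fderiv ℝ δ (p - q) := fun q => by
        have := (hδd (p - q)).hasFDerivAt.comp q ((hasFDerivAt_id q).const_sub p)
        refine this.fderiv.trans ?_
        ext v
        simp
      have := mul_nonneg (hψ.nonneg p) (hp (hψ.subset h1) _ htest)
      simp only [gY, hfd, smul_apply, smul_eq_mul,
        neg_apply, integral_neg, integral_const_mul, Pi.zero_apply] at this ⊢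
      linarith
    · simp [gY, hψK _ h1]
  have hX : 0 ≤ ∫ x, gX x (A x.1 x.2) ∂μ.prod μ := by
    rw [integral_add hXi hYi] at hXY
    linarith
  -- comparison of the doubled integral with the one on the diagonal
  have hδint : ∀ p, ∫ q, δ (p - q) ∂μ = 1 := fun p => by
    rw [integral_sub_left_eq_self δ μ p]; exact b.integral_normed
  have hδi : ∀ p, Integrable (fun q => δ (p - q)) μ := fun p =>
    (integrable_comp_sub_left δ p).2 b.integrable_normed
  rw [integral_prod _ hXi] at hX
  have hdiff : ‖∫ p, ((∫ q, gX (p, q) (A p q) ∂μ) - fderiv ℝ ψ p (A p p)) ∂μ‖ₑ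
      ≤ ENNReal.ofReal C * η := by
    calc _ ≤ ∫⁻ p, ‖(∫ q, gX (p, q) (A p q) ∂μ) - fderiv ℝ ψ p (A p p)‖ₑ ∂μ :=
          enorm_integral_le_lintegral_enorm _
      _ ≤ ∫⁻ p, K.indicator (fun p => ∫⁻ h, ENNReal.ofReal C *
            (ENNReal.ofReal (δ h) * ‖A p (p - h) - A p p‖ₑ) ∂μ) p ∂μ := by
          refine lintegral_mono_ae ?_
          filter_upwards [hXi.prod_right_ae] with p hp
          by_cases h1 : p ∈ K
          · rw [indicator_of_mem h1]
            have e : (∫ q, gX (p, q) (A p q) ∂μ) - fderiv ℝ ψ p (A p p)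
                = ∫ q, δ (p - q) * fderiv ℝ ψ p (A p q - A p p) ∂μ := by
              rw [← one_mul (fderiv ℝ ψ p (A p p)), ← hδint p, ← integral_mul_const,
                ← integral_sub hp ((hδi p).mul_const _)]
              refine integral_congr_ae (ae_of_all _ fun q => ?_)
              simp [gX, mul_sub]
            rw [e]
            refine (enorm_integral_le_lintegral_enorm _).trans ?_
            rw [← lintegral_sub_left_eq_self _ p]
            refine lintegral_mono fun q => ?_
            simp only [sub_sub_cancel]
            rw [enorm_mul, Real.enorm_of_nonneg (hδ0 _), mul_left_comm]
            gcongr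
            refine (ContinuousLinearMap.le_opENorm _ _).trans ?_
            gcongr
            rw [← ofReal_norm]
            exact ENNReal.ofReal_le_ofReal (hC p)
          · simp [gX, hψK' _ h1]
      _ = ∫⁻ p in K, ∫⁻ h, ENNReal.ofReal C *
            (ENNReal.ofReal (δ h) * ‖A p (p - h) - A p p‖ₑ) ∂μ ∂μ :=
          lintegral_indicator hK.measurableSet _
      _ = ∫⁻ h, ∫⁻ p in K, ENNReal.ofReal C *
            (ENNReal.ofReal (δ h) * ‖A p (p - h) - A p p‖ₑ) ∂μ ∂μ := by
          refine lintegral_lintegral_swap ?_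
          have m1 : Measurable fun x : V × V => A x.1 (x.1 - x.2) :=
            hA.comp (measurable_fst.prodMk (measurable_fst.sub measurable_snd))
          have m2 : Measurable fun x : V × V => A x.1 x.1 := hAd.comp measurable_fst
          exact (((hδs.continuous.measurable.comp measurable_snd).ennreal_ofReal.mul
            (m1.sub m2).enorm).const_mul _).aemeasurable
      _ ≤ ∫⁻ h, ENNReal.ofReal C * (ENNReal.ofReal (δ h) * η) ∂μ := by
          refine lintegral_mono fun h => ?_
          have m1 : Measurable fun p : V => ‖A p (p - h) - A p p‖ₑ :=
            ((hA.comp (measurable_id.prodMk (measurable_id.sub_const h))).sub hAd).enorm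
          simp only
          rw [lintegral_const_mul _ (m1.const_mul _), lintegral_const_mul _ m1]
          by_cases h1 : h ∈ tsupport δ
          · gcongr
            refine hsmall ?_
            rw [dist_zero_right]
            by_contra hlt
            exact hδsupp h (Or.inr (not_lt.1 hlt)) h1
          · simp [hδz _ h1]
      _ = ENNReal.ofReal C * η := by
          have m1 : Measurable fun h => ENNReal.ofReal (δ h) :=
            hδs.continuous.measurable.ennreal_ofReal
          rw [lintegral_const_mul _ (m1.mul_const _), lintegral_mul_const _ m1,
            ← ofReal_integral_eq_lintegral_ofReal b.integrable_normed (ae_of_all _ hδ0),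
            b.integral_normed]
          simp
  rw [integral_sub hXi.integral_prod_left hDi] at hdiff
  have hη' : ENNReal.ofReal C * η = ENNReal.ofReal (C * η) := by
    rw [ENNReal.ofReal_mul hC0, ENNReal.ofReal_coe_nnreal]
  rw [hη', ← ofReal_norm, ENNReal.ofReal_le_ofReal_iff (by positivity), Real.norm_eq_abs] at hdiff
  have := (abs_le.1 hdiff).2
  linarith

end Doubling

/-! ### Entropy solutions and the doubled entropy density -/

theorem measurableSet_triangle (a : ℝ) : MeasurableSet (triangle a) := by
  refine (measurableSet_lt measurable_fst measurable_snd).inter ?_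
  exact (measurableSet_le measurable_const measurable_fst).inter
    (measurableSet_le measurable_snd measurable_const)

theorem triangle_subset_Icc (a : ℝ) : triangle a ⊆ Icc (-a) a ×ˢ Icc (-a) a := by
  rintro ⟨r, s⟩ ⟨h1, h2, h3⟩
  have h1 : r < s := h1
  simp only [mem_prod, mem_Icc] at *
  refine ⟨⟨h2, ?_⟩, ?_, h3⟩ <;> linarith

instance isFiniteMeasure_restrict_triangle (a : ℝ) :
    IsFiniteMeasure ((volume : Measure (ℝ × ℝ)).restrict (triangle a)) :=
  ⟨by
    rw [Measure.restrict_apply_univ]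
    exact (measure_mono (triangle_subset_Icc a)).trans_lt
      (isCompact_Icc.prod isCompact_Icc).measure_lt_top⟩

theorem configDist_comm (a : ℝ) (z z' : ℝ × ℝ → ℝ) : configDist a z z' = configDist a z' z := by
  simp only [configDist, abs_sub_comm]

theorem configDist_nonneg (a : ℝ) (z z' : ℝ × ℝ → ℝ) : 0 ≤ configDist a z z' :=
  integral_nonneg fun _ => abs_nonneg _

theorem configDist_congr {a : ℝ} {z₁ z₁' z₂ z₂' : ℝ × ℝ → ℝ}
    (h₁ : z₁ =ᵐ[volume.restrict (triangle a)] z₁') (h₂ : z₂ =ᵐ[volume.restrict (triangle a)] z₂') :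
    configDist a z₁ z₂ = configDist a z₁' z₂' := by
  refine integral_congr_ae ?_
  filter_upwards [h₁, h₂] with ρ e₁ e₂
  rw [e₁, e₂]

theorem configDist_triangle {a : ℝ} {z₁ z₂ z₃ : ℝ × ℝ → ℝ}
    (h₁ : Integrable z₁ (volume.restrict (triangle a)))
    (h₂ : Integrable z₂ (volume.restrict (triangle a)))
    (h₃ : Integrable z₃ (volume.restrict (triangle a))) :
    configDist a z₁ z₃ ≤ configDist a z₁ z₂ + configDist a z₂ z₃ := by
  refine (integral_mono (h₁.sub h₃).abs ((h₁.sub h₂).abs.add (h₂.sub h₃).abs)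
    fun ρ => abs_sub_le _ (z₂ ρ) _).trans_eq ?_
  exact integral_add (h₁.sub h₂).abs (h₂.sub h₃).abs

theorem configDist_le {a : ℝ} {z₁ z₂ : ℝ × ℝ → ℝ}
    (h₁ : ∀ᵐ ρ ∂volume.restrict (triangle a), |z₁ ρ| ≤ 1)
    (h₂ : ∀ᵐ ρ ∂volume.restrict (triangle a), |z₂ ρ| ≤ 1) :
    configDist a z₁ z₂ ≤ 2 * volume.real (triangle a) := by
  have h := norm_integral_le_of_norm_le_const (μ := volume.restrict (triangle a))
    (f := fun ρ => |z₁ ρ - z₂ ρ|) (C := 2) (by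
      filter_upwards [h₁, h₂] with ρ e₁ e₂
      rw [Real.norm_eq_abs, abs_abs]
      exact (abs_sub _ _).trans (by linarith))
  rw [measureReal_restrict_apply_univ] at h
  exact (le_abs_self _).trans h

/-- A pair of an input and a field of relay states, on all of space-time, whose measurability and
size hold everywhere rather than almost everywhere. -/
structure IsRegularPair (U : ℝ × ℝ → ℝ) (Z : ℝ × ℝ → ℝ × ℝ → ℝ) : Prop where
  measurable_fst : Measurable U
  locallyIntegrable : LocallyIntegrable U
  measurable_snd : Measurable (Function.uncurry Z)
  abs_le_one : ∀ p ρ, |Z p ρ| ≤ 1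

theorem IsRegularPair.integrable {U : ℝ × ℝ → ℝ} {Z : ℝ × ℝ → ℝ × ℝ → ℝ}
    (h : IsRegularPair U Z) (a : ℝ) (p : ℝ × ℝ) :
    Integrable (Z p) (volume.restrict (triangle a)) :=
  Integrable.of_bound (h.measurable_snd.comp measurable_prodMk_left).aestronglyMeasurable 1
    (ae_of_all _ fun ρ => h.abs_le_one p ρ)

theorem IsRegularPair.locallyIntegrable_abs {U : ℝ × ℝ → ℝ} {Z : ℝ × ℝ → ℝ × ℝ → ℝ}
    (h : IsRegularPair U Z) : LocallyIntegrable fun p => |U p| :=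
  h.locallyIntegrable.mono h.measurable_fst.abs.aestronglyMeasurable
    (ae_of_all _ fun p => by simp)

/-- The doubled entropy flux and density of two pairs, as a vector field in the variables
`(x, t)`. -/
noncomputable def entropyField (a : ℝ) (U₁ U₂ : ℝ × ℝ → ℝ) (Z₁ Z₂ : ℝ × ℝ → ℝ × ℝ → ℝ)
    (p q : ℝ × ℝ) : ℝ × ℝ :=
  (|U₁ p - U₂ q|, |U₁ p - U₂ q| + configDist a (Z₁ p) (Z₂ q))

section Field

variable {a : ℝ} {U₁ U₂ : ℝ × ℝ → ℝ} {Z₁ Z₂ : ℝ × ℝ → ℝ × ℝ → ℝ}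

theorem entropyField_comm (p q : ℝ × ℝ) :
    entropyField a U₁ U₂ Z₁ Z₂ p q = entropyField a U₂ U₁ Z₂ Z₁ q p := by
  simp only [entropyField, configDist_comm a (Z₁ p), abs_sub_comm (U₁ p)]

theorem measurable_entropyField (h₁ : IsRegularPair U₁ Z₁) (h₂ : IsRegularPair U₂ Z₂) :
    Measurable (Function.uncurry (entropyField a U₁ U₂ Z₁ Z₂)) := by
  have hF : Measurable fun x : (ℝ × ℝ) × (ℝ × ℝ) => |U₁ x.1 - U₂ x.2| :=
    ((h₁.measurable_fst.comp measurable_fst).sub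
      (h₂.measurable_fst.comp measurable_snd)).abs
  have hz : Measurable fun y : ((ℝ × ℝ) × (ℝ × ℝ)) × (ℝ × ℝ) =>
      |Z₁ y.1.1 y.2 - Z₂ y.1.2 y.2| :=
    ((h₁.measurable_snd.comp ((measurable_fst.comp measurable_fst).prodMk measurable_snd)).sub
      (h₂.measurable_snd.comp ((measurable_snd.comp measurable_fst).prodMk measurable_snd))).abs
  have hD : Measurable fun x : (ℝ × ℝ) × (ℝ × ℝ) => configDist a (Z₁ x.1) (Z₂ x.2) :=
    (StronglyMeasurable.integral_prod_right' (ν := volume.restrict (triangle a))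
      hz.stronglyMeasurable).measurable
  exact hF.prodMk (hF.add hD)

theorem norm_entropyField_le (h₁ : IsRegularPair U₁ Z₁) (h₂ : IsRegularPair U₂ Z₂) (p q : ℝ × ℝ) :
    ‖entropyField a U₁ U₂ Z₁ Z₂ p q‖ ≤
      (|U₁ p| + 2 * volume.real (triangle a)) + |U₂ q| := by
  have hd := configDist_le (a := a) (ae_of_all _ (h₁.abs_le_one p)) (ae_of_all _ (h₂.abs_le_one q))
  have hd0 := configDist_nonneg a (Z₁ p) (Z₂ q)
  have hu := abs_sub (U₁ p) (U₂ q)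
  rw [entropyField, Prod.norm_mk, Real.norm_of_nonneg (abs_nonneg _),
    Real.norm_of_nonneg (by positivity)]
  refine max_le ?_ ?_ <;> linarith

/-- The doubled field is Lipschitz in the second state, with respect to `|u - u'| + d(z, z')`. -/
theorem enorm_entropyField_sub_le (h₁ : IsRegularPair U₁ Z₁) (h₂ : IsRegularPair U₂ Z₂)
    (p q q' : ℝ × ℝ) :
    ‖entropyField a U₁ U₂ Z₁ Z₂ p q - entropyField a U₁ U₂ Z₁ Z₂ p q'‖ₑ ≤
      ‖U₂ q - U₂ q'‖ₑ + ∫⁻ ρ in triangle a, ‖Z₂ q ρ - Z₂ q' ρ‖ₑ := by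
  have hu := abs_abs_sub_abs_le (U₁ p - U₂ q) (U₁ p - U₂ q')
  rw [sub_sub_sub_cancel_left, abs_sub_comm (U₂ q')] at hu
  have hi : Integrable (fun ρ => Z₂ q ρ - Z₂ q' ρ) (volume.restrict (triangle a)) :=
    (h₂.integrable a q).sub (h₂.integrable a q')
  have hz : |configDist a (Z₁ p) (Z₂ q) - configDist a (Z₁ p) (Z₂ q')|
      ≤ configDist a (Z₂ q) (Z₂ q') := by
    have t1 := configDist_triangle (h₁.integrable a p) (h₂.integrable a q') (h₂.integrable a q)
    have t2 := configDist_triangle (h₁.integrable a p) (h₂.integrable a q) (h₂.integrable a q')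
    rw [configDist_comm a (Z₂ q')] at t1
    rw [abs_le]; constructor <;> linarith
  have hn : ‖entropyField a U₁ U₂ Z₁ Z₂ p q - entropyField a U₁ U₂ Z₁ Z₂ p q'‖
      ≤ |U₂ q - U₂ q'| + configDist a (Z₂ q) (Z₂ q') := by
    rw [entropyField, entropyField, Prod.mk_sub_mk, Prod.norm_mk, Real.norm_eq_abs,
      Real.norm_eq_abs]
    refine max_le ?_ ?_
    · linarith [configDist_nonneg a (Z₂ q) (Z₂ q')]
    · rw [add_sub_add_comm]
      exact (abs_add_le _ _).trans (add_le_add hu hz)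
  rw [← ofReal_norm]
  refine (ENNReal.ofReal_le_ofReal hn).trans ?_
  rw [ENNReal.ofReal_add (abs_nonneg _) (configDist_nonneg _ _ _), ← Real.norm_eq_abs, ofReal_norm,
    configDist, ofReal_integral_eq_lintegral_ofReal hi.abs (ae_of_all _ fun _ => abs_nonneg _)]
  simp only [← Real.norm_eq_abs, ofReal_norm]
  exact le_rfl

theorem tendsto_entropyField_translate (h₁ : IsRegularPair U₁ Z₁) (h₂ : IsRegularPair U₂ Z₂)
    {K : Set (ℝ × ℝ)} (hK : IsCompact K) :
    Tendsto (fun h => ∫⁻ p in K, ‖entropyField a U₁ U₂ Z₁ Z₂ p (p - h)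
      - entropyField a U₁ U₂ Z₁ Z₂ p p‖ₑ) (𝓝 0) (𝓝 0) := by
  have hU := tendsto_setLIntegral_translate_sub h₂.locallyIntegrable hK
  have hZi : LocallyIntegrable (Function.uncurry Z₂) := by
    have h1 : LocallyIntegrable (fun _ : (ℝ × ℝ) × (ℝ × ℝ) => (1 : ℝ)) := locallyIntegrable_const 1
    refine h1.mono h₂.measurable_snd.aestronglyMeasurable (ae_of_all _ fun x => ?_)
    simpa [Function.uncurry] using h₂.abs_le_one x.1 x.2
  have hK2 : IsCompact (K ×ˢ (Icc (-a) a ×ˢ Icc (-a) a)) :=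
    hK.prod (isCompact_Icc.prod isCompact_Icc)
  have hc : Tendsto (fun h : ℝ × ℝ => (h, (0 : ℝ × ℝ))) (𝓝 0) (𝓝 0) :=
    (continuous_id.prodMk continuous_const).tendsto 0
  have : (volume : Measure ((ℝ × ℝ) × (ℝ × ℝ))).IsAddHaarMeasure :=
    inferInstanceAs ((volume : Measure (ℝ × ℝ)).prod volume).IsAddHaarMeasure
  have hZ := (tendsto_setLIntegral_translate_sub hZi hK2).comp hc
  have hUZ := hU.add hZ
  rw [add_zero] at hUZ
  refine tendsto_of_tendsto_of_tendsto_of_le_of_le tendsto_const_nhds hUZ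
    (fun _ => zero_le) fun h => ?_
  have mU : Measurable fun p => ‖U₂ (p - h) - U₂ p‖ₑ :=
    ((h₂.measurable_fst.comp (measurable_id.sub_const h)).sub h₂.measurable_fst).enorm
  have mZ : Measurable fun x : (ℝ × ℝ) × (ℝ × ℝ) => ‖Z₂ (x.1 - h) x.2 - Z₂ x.1 x.2‖ₑ :=
    ((h₂.measurable_snd.comp ((measurable_fst.sub_const h).prodMk measurable_snd)).sub
      h₂.measurable_snd).enorm
  refine (lintegral_mono fun p => enorm_entropyField_sub_le h₁ h₂ p (p - h) p).trans ?_
  rw [lintegral_add_left mU]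
  refine add_le_add le_rfl ?_
  rw [← lintegral_prod _ mZ.aemeasurable, Measure.prod_restrict]
  refine (lintegral_mono_set (prod_mono le_rfl (triangle_subset_Icc a))).trans ?_
  simp only [Function.comp, Function.uncurry]
  refine lintegral_mono fun x => ?_
  simp

end Field

/-- The strip `ℝ × (0, T)` of space-time. -/
abbrev strip (T : ℝ) : Set (ℝ × ℝ) := univ ×ˢ Ioo 0 T

/-- The constraints of a solution are those of the closure of the hysteresis region; the boundary
is met only by thresholds with `ρ₁ = u` or `ρ₂ = u`, which form a null set. -/
theorem IsEntropySolution.ae_mem_relayRegion {a T : ℝ} {u₀ : ℝ → ℝ} {z₀ : ℝ → ℝ × ℝ → ℝ}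
    {u w : ℝ → ℝ → ℝ} {z : ℝ → ℝ → ℝ × ℝ → ℝ} (h : IsEntropySolution a T u₀ z₀ u w z) :
    ∀ᵐ p : ℝ × ℝ ∂volume.restrict (strip T), ∀ᵐ ρ ∂volume.restrict (triangle a),
      (u p.1 p.2, z p.1 p.2 ρ) ∈ relayRegion ρ := by
  filter_upwards [h.compatible] with p hp
  have n1 : ∀ᵐ ρ : ℝ × ℝ ∂volume.restrict (triangle a), ρ.1 ≠ u p.1 p.2 := by
    refine ae_restrict_of_ae ?_
    exact (Measure.quasiMeasurePreserving_fst (μ := (volume : Measure ℝ))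
      (ν := (volume : Measure ℝ))).ae (Measure.ae_ne volume _)
  have n2 : ∀ᵐ ρ : ℝ × ℝ ∂volume.restrict (triangle a), ρ.2 ≠ u p.1 p.2 := by
    refine ae_restrict_of_ae ?_
    exact (Measure.quasiMeasurePreserving_snd (μ := (volume : Measure ℝ))
      (ν := (volume : Measure ℝ))).ae (Measure.ae_ne volume _)
  filter_upwards [hp, n1, n2] with ρ ⟨h1, h2, h3⟩ e1 e2
  rcases eq_or_eq_neg_of_abs_eq h1 with hz | hz
  · rw [hz] at h3
    exact Or.inl ⟨lt_of_le_of_ne (by linarith) e1, hz⟩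
  · rw [hz] at h2
    exact Or.inr ⟨lt_of_le_of_ne (by linarith) e2.symm, hz⟩

/-- A solution has a representative that is measurable everywhere, extended by zero outside the
strip in `u`, with relay states truncated to `[-1, 1]`. -/
theorem IsEntropySolution.exists_regularPair {a T : ℝ} {u₀ : ℝ → ℝ} {z₀ : ℝ → ℝ × ℝ → ℝ}
    {u w : ℝ → ℝ → ℝ} {z : ℝ → ℝ → ℝ × ℝ → ℝ} (h : IsEntropySolution a T u₀ z₀ u w z) :
    ∃ U Z, IsRegularPair U Z ∧ ∀ᵐ p : ℝ × ℝ ∂volume.restrict (strip T),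
      U p = u p.1 p.2 ∧ Z p =ᵐ[volume.restrict (triangle a)] z p.1 p.2 := by
  have hS : MeasurableSet (strip T) := MeasurableSet.univ.prod measurableSet_Ioo
  -- the input
  have hu : LocallyIntegrable ((strip T).indicator fun p : ℝ × ℝ => u p.1 p.2) := by
    rw [locallyIntegrable_iff]
    intro K hK
    obtain ⟨R, hR⟩ := (hK.image continuous_fst).isBounded.subset_closedBall 0
    rw [Real.closedBall_eq_Icc, zero_sub, zero_add] at hR
    rw [integrableOn_indicator_iff hS]
    refine (h.integrableOn R).mono_set ?_
    rintro p ⟨hp, hpK⟩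
    exact ⟨hR (mem_image_of_mem _ hpK), hp.2⟩
  have hum := hu.aestronglyMeasurable.aemeasurable
  -- the states of the relays
  have hz : AEMeasurable (fun y : (ℝ × ℝ) × (ℝ × ℝ) => z y.1.1 y.1.2 y.2)
      ((volume.restrict (strip T)).prod (volume.restrict (triangle a))) := by
    rw [Measure.prod_restrict]
    have mp := (volume_preserving_prodAssoc (α₁ := ℝ) (β₁ := ℝ) (γ₁ := ℝ × ℝ)).restrict_preimage
      (s := univ ×ˢ Ioo 0 T ×ˢ triangle a)
      (MeasurableSet.univ.prod (measurableSet_Ioo.prod (measurableSet_triangle a)))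
    have e : (MeasurableEquiv.prodAssoc : (ℝ × ℝ) × (ℝ × ℝ) ≃ᵐ ℝ × ℝ × (ℝ × ℝ)) ⁻¹'
        (univ ×ˢ Ioo 0 T ×ˢ triangle a) = strip T ×ˢ triangle a := by
      ext y
      simp [MeasurableEquiv.prodAssoc]
    rw [e] at mp
    exact h.aemeasurable.comp_quasiMeasurePreserving mp.quasiMeasurePreserving
  refine ⟨hum.mk _, fun p ρ => max (-1) (min 1 (hz.mk _ (p, ρ))), ⟨hum.measurable_mk, ?_, ?_, ?_⟩,
    ?_⟩
  · exact hu.congr hum.ae_eq_mk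
  · exact measurable_const.max (measurable_const.min hz.measurable_mk)
  · intro p ρ
    rw [abs_le]
    exact ⟨le_max_left _ _, max_le (by norm_num) (min_le_left _ _)⟩
  · filter_upwards [ae_restrict_of_ae hum.ae_eq_mk, ae_restrict_mem hS,
      Measure.ae_ae_of_ae_prod hz.ae_eq_mk, h.compatible] with p h1 hp h2 h3
    refine ⟨by rw [← h1, indicator_of_mem hp], ?_⟩
    filter_upwards [h2, h3] with ρ e1 e2
    have := abs_le.1 e2.1.le
    rw [← e1,  min_eq_right this.2, max_eq_right this.1]

/-- The entropy condition of a solution, with another solution at the point `q` as the constant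
state. -/
theorem IsEntropySolution.ae_entropy_nonneg {a T : ℝ} {u₀ u₀' : ℝ → ℝ} {z₀ z₀' : ℝ → ℝ × ℝ → ℝ}
    {u w u' w' : ℝ → ℝ → ℝ} {z z' : ℝ → ℝ → ℝ × ℝ → ℝ}
    (h : IsEntropySolution a T u₀ z₀ u w z) (h' : IsEntropySolution a T u₀' z₀' u' w' z')
    {U U' : ℝ × ℝ → ℝ} {Z Z' : ℝ × ℝ → ℝ × ℝ → ℝ}
    (hU : ∀ᵐ p : ℝ × ℝ ∂volume.restrict (strip T),
      U p = u p.1 p.2 ∧ Z p =ᵐ[volume.restrict (triangle a)] z p.1 p.2)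
    (hU' : ∀ᵐ p : ℝ × ℝ ∂volume.restrict (strip T),
      U' p = u' p.1 p.2 ∧ Z' p =ᵐ[volume.restrict (triangle a)] z' p.1 p.2) :
    ∀ᵐ q : ℝ × ℝ, q ∈ strip T → ∀ φ, IsTest (strip T) φ →
      0 ≤ ∫ p, fderiv ℝ φ p (entropyField a U U' Z Z' p q) := by
  have hS : MeasurableSet (strip T) := MeasurableSet.univ.prod measurableSet_Ioo
  rw [← ae_restrict_iff' hS]
  filter_upwards [h'.mem, h'.ae_mem_relayRegion, hU'] with q hq1 hq2 hq3 φ hφ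
  have := h.entropy (u' q.1 q.2) (z' q.1 q.2) hq1 hq2 φ hφ.contDiff hφ.compact
    (hφ.subset.trans (prod_mono le_rfl Ioo_subset_Ioi_self)) hφ.nonneg
  refine this.trans_eq ?_
  have hsupp : (Function.support fun p => fderiv ℝ φ p (entropyField a U U' Z Z' p q))
      ⊆ strip T := by
    intro p hp
    refine hφ.subset (tsupport_fderiv_subset ℝ (subset_tsupport _ ?_))
    rintro h0
    simp [h0] at hp
  rw [← setIntegral_eq_integral_of_forall_compl_eq_zero (s := strip T)
    fun p hp => by_contra fun h0 => hp (hsupp h0)]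
  refine integral_congr_ae ?_
  filter_upwards [hU] with p hp
  have e : entropyField a U U' Z Z' p q =
      (|u p.1 p.2 - u' q.1 q.2| + configDist a (z p.1 p.2) (z' q.1 q.2)) • ((0 : ℝ), (1 : ℝ))
        + |u p.1 p.2 - u' q.1 q.2| • ((1 : ℝ), (0 : ℝ)) := by
    rw [entropyField, hp.1, hq3.1, configDist_congr hp.2 hq3.2]
    simp
  rw [e, map_add, map_smul, map_smul, smul_eq_mul, smul_eq_mul]

/-- Kružkov's inequality for two entropy solutions. -/
theorem IsEntropySolution.kruzkov {a T : ℝ} {u₀ u₀' : ℝ → ℝ} {z₀ z₀' : ℝ → ℝ × ℝ → ℝ}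
    {u w u' w' : ℝ → ℝ → ℝ} {z z' : ℝ → ℝ → ℝ × ℝ → ℝ}
    (h : IsEntropySolution a T u₀ z₀ u w z) (h' : IsEntropySolution a T u₀' z₀' u' w' z')
    {U U' : ℝ × ℝ → ℝ} {Z Z' : ℝ × ℝ → ℝ × ℝ → ℝ} (hp : IsRegularPair U Z)
    (hp' : IsRegularPair U' Z')
    (hU : ∀ᵐ p : ℝ × ℝ ∂volume.restrict (strip T),
      U p = u p.1 p.2 ∧ Z p =ᵐ[volume.restrict (triangle a)] z p.1 p.2)
    (hU' : ∀ᵐ p : ℝ × ℝ ∂volume.restrict (strip T),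
      U' p = u' p.1 p.2 ∧ Z' p =ᵐ[volume.restrict (triangle a)] z' p.1 p.2)
    {ψ : ℝ × ℝ → ℝ} (hψ : IsTest (strip T) ψ) :
    0 ≤ ∫ p, fderiv ℝ ψ p (entropyField a U U' Z Z' p p) := by
  refine doubling_of_variables (measurable_entropyField hp hp')
    (hp.locallyIntegrable_abs.add (locallyIntegrable_const (2 * volume.real (triangle a))))
    hp'.locallyIntegrable_abs (norm_entropyField_le hp hp')
    (fun K hK => tendsto_entropyField_translate hp hp' hK) (isOpen_univ.prod isOpen_Ioo)
    (h.ae_entropy_nonneg h' hU hU') ?_ hψ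
  simp only [entropyField_comm (a := a) (U₁ := U)]
  exact h'.ae_entropy_nonneg h hU' hU

/-! ### Functions with nonpositive distributional derivative -/

/-- A locally integrable function whose distributional derivative on `(0, T)` is nonpositive is
nonincreasing on a set of full measure, the set of points where its mollifications converge. -/
theorem ae_antitone_of_forall_isTest {T : ℝ} {G : ℝ → ℝ} (hG : LocallyIntegrable G)
    (h : ∀ χ, IsTest (Ioo 0 T) χ → 0 ≤ ∫ t, deriv χ t * G t) :
    ∃ D : Set ℝ, (∀ᵐ t, t ∈ D) ∧
      ∀ s ∈ D, ∀ t ∈ D, 0 < s → s < t → t < T → G t ≤ G s := by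
  let b : ℕ → ContDiffBump (0 : ℝ) := fun n =>
    ⟨1 / ((n : ℝ) + 1) / 2, 1 / ((n : ℝ) + 1), by positivity,
      half_lt_self (by positivity)⟩
  have hb : Tendsto (fun n => (b n).rOut) atTop (𝓝 0) := tendsto_one_div_add_atTop_nhds_zero_nat
  have hconv := ContDiffBump.ae_convolution_tendsto_right_of_locallyIntegrable (μ := volume)
    (φ := b) (K := 2) hb (Eventually.of_forall fun n => by
      change 1 / ((n : ℝ) + 1) ≤ 2 * (1 / ((n : ℝ) + 1) / 2)
      linarith) hG
  refine ⟨_, hconv, fun s hs t ht h0 hst hT => ?_⟩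
  refine le_of_tendsto_of_tendsto ht hs ?_
  filter_upwards [hb.eventually_lt_const (show 0 < min s (T - t) from lt_min h0 (by linarith))]
    with n hn
  obtain ⟨hn1, hn2⟩ := lt_min_iff.1 hn
  set δ := (b n).normed volume with hδ
  have hδs : ContDiff ℝ ∞ δ := (b n).contDiff_normed
  have hδc := hδs.continuous
  have hδK : HasCompactSupport δ := (b n).hasCompactSupport_normed
  have hδ0 : ∀ r, 0 ≤ δ r := (b n).nonneg_normed
  have hδz : ∀ r, (b n).rOut < |r| → δ r = 0 := fun r hr => by
    refine image_eq_zero_of_notMem_tsupport fun hmem => ?_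
    rw [hδ, (b n).tsupport_normed_eq, mem_closedBall_zero_iff, Real.norm_eq_abs] at hmem
    linarith
  -- the test function whose derivative is the difference of the bumps at `s` and at `t`
  let χ : ℝ → ℝ := fun r => ∫ y in (r - t)..(r - s), δ y
  have hχd : ∀ r, HasDerivAt χ (δ (r - s) - δ (r - t)) r := by
    intro r
    have e : χ = fun r => (∫ y in (0 : ℝ)..(r - s), δ y) - ∫ y in (0 : ℝ)..(r - t), δ y := by
      ext r
      exact (intervalIntegral.integral_interval_sub_left (hδc.intervalIntegrable _ _)
        (hδc.intervalIntegrable _ _)).symm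
    have hH : ∀ x, HasDerivAt (fun r => ∫ y in (0 : ℝ)..r, δ y) (δ x) x := fun x =>
      hδc.integral_hasStrictDerivAt 0 x |>.hasDerivAt
    rw [e]
    exact ((hH (r - s)).comp_sub_const r s).sub ((hH (r - t)).comp_sub_const r t)
  have hχd' : deriv χ = fun r => δ (r - s) - δ (r - t) := funext fun r => (hχd r).deriv
  have hsupp : tsupport χ ⊆ Icc (s - (b n).rOut) (t + (b n).rOut) := by
    refine closure_minimal (fun r hr => ?_) isClosed_Icc
    by_contra hmem
    refine hr (intervalIntegral.integral_zero_ae (ae_of_all _ fun y hy => hδz y ?_))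
    rw [uIoc_of_le (by linarith)] at hy
    rw [mem_Icc, not_and_or, not_le, not_le] at hmem
    rcases hmem with h1 | h1
    · exact lt_of_lt_of_le (by linarith [hy.2]) (neg_le_abs y)
    · exact lt_of_lt_of_le (by linarith [hy.1]) (le_abs_self y)
  have htest : IsTest (Ioo 0 T) χ :=
    { contDiff := by
        rw [contDiff_infty_iff_deriv, hχd']
        exact ⟨fun r => (hχd r).differentiableAt, (hδs.comp (contDiff_id.sub contDiff_const)).sub
          (hδs.comp (contDiff_id.sub contDiff_const))⟩
      compact := isCompact_Icc.of_isClosed_subset (isClosed_tsupport _) hsupp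
      subset := hsupp.trans (Icc_subset_Ioo (by linarith) (by linarith))
      nonneg := fun r => intervalIntegral.integral_nonneg (by linarith) fun y _ => hδ0 y }
  have hi : ∀ x, Integrable fun r => δ (r - x) * G r := fun x =>
    hG.integrable_smul_left_of_hasCompactSupport (hδc.comp (continuous_sub_right x))
      (hδK.comp_homeomorph (Homeomorph.subRight x))
  have hc : ∀ x, convolution δ G (ContinuousLinearMap.lsmul ℝ ℝ) volume x
      = ∫ r, δ (r - x) * G r := fun x => by
    rw [convolution_lsmul_swap]
    refine integral_congr_ae (ae_of_all _ fun r => ?_)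
    simp only [smul_eq_mul]
    rw [← neg_sub r x, hδ, (b n).normed_neg]
  have := h χ htest
  simp only [hχd', sub_mul] at this
  rw [integral_sub (hi s) (hi t)] at this
  rw [hc, hc]
  linarith

/-! ### Finite speed of propagation -/

/-- A smooth cutoff, equal to `1` for `t - R ≤ x ≤ R` and to `0` unless `t - R - 1 < x < R + 1`.
Its right edge is at rest and its left edge moves with speed `1`: these are the extreme speeds of
propagation, so that nothing enters its support. -/
noncomputable def coneCutoff (R : ℝ) (p : ℝ × ℝ) : ℝ :=
  Real.smoothTransition (R + 1 - p.1) * Real.smoothTransition (p.1 - p.2 + R + 1)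

theorem contDiff_coneCutoff (R : ℝ) : ContDiff ℝ ∞ (coneCutoff R) :=
  (Real.smoothTransition.contDiff.comp (contDiff_const.sub contDiff_fst)).mul
    (Real.smoothTransition.contDiff.comp
      (((contDiff_fst.sub contDiff_snd).add contDiff_const).add contDiff_const))

theorem coneCutoff_nonneg (R : ℝ) (p : ℝ × ℝ) : 0 ≤ coneCutoff R p :=
  mul_nonneg (Real.smoothTransition.nonneg _) (Real.smoothTransition.nonneg _)

theorem coneCutoff_le_one (R : ℝ) (p : ℝ × ℝ) : coneCutoff R p ≤ 1 :=
  mul_le_one₀ (Real.smoothTransition.le_one _) (Real.smoothTransition.nonneg _)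
    (Real.smoothTransition.le_one _)

theorem coneCutoff_eq_one {R : ℝ} {p : ℝ × ℝ} (h₁ : p.1 ≤ R) (h₂ : p.2 - R ≤ p.1) :
    coneCutoff R p = 1 := by
  rw [coneCutoff, Real.smoothTransition.one_of_one_le (by linarith),
    Real.smoothTransition.one_of_one_le (by linarith), one_mul]

theorem coneCutoff_eq_zero {R : ℝ} {p : ℝ × ℝ} (h : p.1 ∉ Icc (p.2 - R - 1) (R + 1)) :
    coneCutoff R p = 0 := by
  rw [mem_Icc, not_and_or, not_le, not_le] at h
  rcases h with h | h
  · rw [coneCutoff, Real.smoothTransition.zero_of_nonpos (x := p.1 - p.2 + R + 1) (by linarith),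
      mul_zero]
  · rw [coneCutoff, Real.smoothTransition.zero_of_nonpos (x := R + 1 - p.1) (by linarith),
      zero_mul]

/-- The cutoff does not increase in the directions `(f, e)` with `0 ≤ f ≤ e`, where `f` is the
flux and `e` the density. -/
theorem fderiv_coneCutoff_nonpos (R : ℝ) (p : ℝ × ℝ) {f e : ℝ} (hf : 0 ≤ f) (hfe : f ≤ e) :
    fderiv ℝ (coneCutoff R) p (f, e) ≤ 0 := by
  have hS : ∀ x, HasDerivAt Real.smoothTransition (deriv Real.smoothTransition x) x := fun x =>
    (Real.smoothTransition.contDiff (n := 1)).differentiable (by simp) x |>.hasDerivAt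
  have hS0 : ∀ x, 0 ≤ deriv Real.smoothTransition x := fun x =>
    Real.smoothTransition.monotone.deriv_nonneg
  have h1 : HasFDerivAt (fun p : ℝ × ℝ => R + 1 - p.1) (-ContinuousLinearMap.fst ℝ ℝ ℝ) p :=
    hasFDerivAt_fst.const_sub _
  have h2 : HasFDerivAt (fun p : ℝ × ℝ => p.1 - p.2 + R + 1)
      (ContinuousLinearMap.fst ℝ ℝ ℝ - ContinuousLinearMap.snd ℝ ℝ ℝ) p :=
    ((hasFDerivAt_fst.sub hasFDerivAt_snd).add_const _).add_const _
  have h3 := ((hS _).comp_hasFDerivAt p h1).mul ((hS _).comp_hasFDerivAt p h2)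
  have h4 : HasFDerivAt (coneCutoff R) _ p := h3
  rw [h4.fderiv]
  have a1 := mul_nonneg (mul_nonneg (Real.smoothTransition.nonneg (R + 1 - p.1))
    (hS0 (p.1 - p.2 + R + 1))) (sub_nonneg.2 hfe)
  have a2 := mul_nonneg (mul_nonneg (Real.smoothTransition.nonneg (p.1 - p.2 + R + 1))
    (hS0 (R + 1 - p.1))) hf
  simp
  linarith

/-- If the flux `F` and the density `E` satisfy Kružkov's inequality, the mass of `E` inside a
cutoff is nonincreasing in time, up to a null set of times. The test functions are products of the
cutoff with functions of time. -/
theorem ae_antitone_integral_coneCutoff {T : ℝ} {F E : ℝ × ℝ → ℝ}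
    (hF : LocallyIntegrable F) (hE : LocallyIntegrable E) (hF0 : ∀ p, 0 ≤ F p)
    (hFE : ∀ p, F p ≤ E p)
    (h : ∀ ψ, IsTest (strip T) ψ → 0 ≤ ∫ p, fderiv ℝ ψ p (F p, E p)) (R : ℝ) :
    ∃ D : Set ℝ, (∀ᵐ t, t ∈ D) ∧ ∀ s ∈ D, ∀ t ∈ D, 0 < s → s < t → t < T →
      ∫ x, coneCutoff R (x, t) * E (x, t) ≤ ∫ x, coneCutoff R (x, s) * E (x, s) := by
  have hκ := (contDiff_coneCutoff R).continuous
  have hκE : LocallyIntegrable fun p => coneCutoff R p * E p := by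
    refine hE.mono (hκ.aestronglyMeasurable.mul hE.aestronglyMeasurable) (ae_of_all _ fun p => ?_)
    rw [norm_mul, Real.norm_of_nonneg (coneCutoff_nonneg R p)]
    exact mul_le_of_le_one_left (norm_nonneg _) (coneCutoff_le_one R p)
  refine ae_antitone_of_forall_isTest ?_ fun χ hχ => ?_
  · rw [locallyIntegrable_iff]
    intro I hI
    obtain ⟨M, hM⟩ := hI.isBounded.subset_closedBall 0
    rw [Real.closedBall_eq_Icc, zero_sub, zero_add] at hM
    have h1 : IntegrableOn (fun p => coneCutoff R p * E p)
        (Icc (-M - R - 1) (R + 1) ×ˢ I) := hκE.integrableOn_isCompact (isCompact_Icc.prod hI)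
    have h2 : IntegrableOn (fun p => coneCutoff R p * E p) (univ ×ˢ I) := by
      refine h1.of_forall_sdiff_eq_zero (MeasurableSet.univ.prod hI.measurableSet) ?_
      rintro p ⟨⟨-, hp⟩, hp'⟩
      rw [coneCutoff_eq_zero, zero_mul]
      intro h3
      exact hp' ⟨⟨by linarith [(hM hp).1, h3.1], h3.2⟩, hp⟩
    rw [IntegrableOn, Measure.volume_eq_prod, ← Measure.prod_restrict, Measure.restrict_univ] at h2
    exact h2.integral_prod_right
  · have hχs := hχ.contDiff
    have hχ' : Continuous (deriv χ) := hχs.continuous_deriv (by simp)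
    have hκz : ∀ p : ℝ × ℝ, p ∉ Icc (-R - 1) (R + 1) ×ˢ tsupport χ → p.2 ∈ tsupport χ →
        coneCutoff R p = 0 := by
      intro p hp hp2
      refine coneCutoff_eq_zero fun h3 => hp ⟨⟨?_, h3.2⟩, hp2⟩
      linarith [h3.1, (hχ.subset hp2).1]
    have hcomp : IsCompact (Icc (-R - 1) (R + 1) ×ˢ tsupport χ) := isCompact_Icc.prod hχ.compact
    have hsupp : tsupport (fun p : ℝ × ℝ => χ p.2 * coneCutoff R p)
        ⊆ Icc (-R - 1) (R + 1) ×ˢ tsupport χ := by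
      refine closure_minimal (fun p hp => ?_) hcomp.isClosed
      by_contra hp'
      have h2 : p.2 ∈ tsupport χ := subset_tsupport _ fun h0 => hp (by simp [h0])
      exact hp (by simp [hκz p hp' h2])
    have htest : IsTest (strip T) fun p : ℝ × ℝ => χ p.2 * coneCutoff R p :=
      { contDiff := (hχs.comp contDiff_snd).mul (contDiff_coneCutoff R)
        compact := hcomp.of_isClosed_subset (isClosed_tsupport _) hsupp
        subset := hsupp.trans (prod_mono (subset_univ _) hχ.subset)
        nonneg := fun p => mul_nonneg (hχ.nonneg _) (coneCutoff_nonneg R p) }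
    have hi : Integrable fun p : ℝ × ℝ => (deriv χ p.2 * coneCutoff R p) * E p := by
      refine hE.integrable_smul_left_of_hasCompactSupport
        ((hχ'.comp continuous_snd).mul hκ) (HasCompactSupport.intro hcomp fun p hp => ?_)
      by_cases h2 : p.2 ∈ tsupport χ
      · simp [hκz p hp h2]
      · have : deriv χ p.2 = 0 := by
          by_contra h0
          exact h2 (support_deriv_subset h0)
        simp [this]
    have hFEi : Integrable fun p : ℝ × ℝ => fderiv ℝ (fun p : ℝ × ℝ => χ p.2 * coneCutoff R p) p
        (F p, E p) := by
      refine integrable_apply_of_hasCompactSupport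
        (htest.contDiff.continuous_fderiv (by simp)) (htest.compact.fderiv ℝ) ?_
      refine (hF.add hE).mono (hF.aestronglyMeasurable.prodMk hE.aestronglyMeasurable)
        (ae_of_all _ fun p => ?_)
      have := hF0 p
      have := hFE p
      rw [Prod.norm_mk, Pi.add_apply, Real.norm_of_nonneg (hF0 p), Real.norm_of_nonneg (by linarith),
        Real.norm_of_nonneg (by linarith)]
      refine max_le ?_ ?_ <;> linarith
    have hle : ∫ p, fderiv ℝ (fun p : ℝ × ℝ => χ p.2 * coneCutoff R p) p (F p, E p)
        ≤ ∫ p, (deriv χ p.2 * coneCutoff R p) * E p := by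
      refine integral_mono hFEi hi fun p => ?_
      have d1 : HasFDerivAt (fun p : ℝ × ℝ => χ p.2)
          (deriv χ p.2 • ContinuousLinearMap.snd ℝ ℝ ℝ) p :=
        (hχs.differentiable (by simp) p.2).hasDerivAt.comp_hasFDerivAt p hasFDerivAt_snd
      have d2 := ((contDiff_coneCutoff R).differentiable (by simp) p).hasFDerivAt
      have d3 : HasFDerivAt (fun p : ℝ × ℝ => χ p.2 * coneCutoff R p) _ p := d1.mul d2
      have hneg := mul_nonneg (hχ.nonneg p.2)
        (neg_nonneg.2 (fderiv_coneCutoff_nonpos R p (hF0 p) (hFE p)))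
      simp only [d3.fderiv]
      simp
      linarith
    refine ((h _ htest).trans hle).trans_eq ?_
    rw [Measure.volume_eq_prod, integral_prod_symm _ hi]
    refine integral_congr_ae (ae_of_all _ fun t => ?_)
    simp only [mul_assoc]
    rw [integral_const_mul]

/-! ### Fields of configurations over the line -/

/-- A jointly measurable field `z` of relay states over the line, bounded by `1`. -/
structure IsStateField (a : ℝ) (z : ℝ → ℝ × ℝ → ℝ) : Prop where
  aemeasurable : AEMeasurable (Function.uncurry z)
    ((volume : Measure ℝ).prod (volume.restrict (triangle a)))
  abs_le_one : ∀ᵐ x : ℝ, ∀ᵐ ρ ∂volume.restrict (triangle a), |z x ρ| ≤ 1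

section StateField

variable {a : ℝ} {z z' z'' : ℝ → ℝ × ℝ → ℝ}

theorem IsStateField.ae_integrable (h : IsStateField a z) :
    ∀ᵐ x : ℝ, Integrable (z x) (volume.restrict (triangle a)) := by
  filter_upwards [h.aemeasurable.aestronglyMeasurable.prodMk_left, h.abs_le_one] with x h1 h2
  exact Integrable.of_bound h1 1 h2

theorem IsStateField.aestronglyMeasurable_configDist (h : IsStateField a z)
    (h' : IsStateField a z') : AEStronglyMeasurable (fun x => configDist a (z x) (z' x)) :=
  (h.aemeasurable.sub h'.aemeasurable).abs.aestronglyMeasurable.integral_prod_right'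

theorem IsStateField.integrableOn_configDist (h : IsStateField a z) (h' : IsStateField a z')
    {s : Set ℝ} (hs : volume s ≠ ⊤) :
    IntegrableOn (fun x => configDist a (z x) (z' x)) s := by
  refine Measure.integrableOn_of_bounded (M := 2 * volume.real (triangle a)) hs
    (h.aestronglyMeasurable_configDist h') (ae_restrict_of_ae ?_)
  filter_upwards [h.abs_le_one, h'.abs_le_one] with x h1 h2
  rw [Real.norm_of_nonneg (configDist_nonneg _ _ _)]
  exact configDist_le h1 h2

theorem IsStateField.ae_configDist_triangle (h : IsStateField a z) (h' : IsStateField a z')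
    (h'' : IsStateField a z'') :
    ∀ᵐ x : ℝ, configDist a (z x) (z'' x) ≤ configDist a (z x) (z' x)
      + configDist a (z' x) (z'' x) := by
  filter_upwards [h.ae_integrable, h'.ae_integrable, h''.ae_integrable] with x h1 h2 h3
  exact configDist_triangle h1 h2 h3

theorem IsRegularPair.isStateField {U : ℝ × ℝ → ℝ} {Z : ℝ × ℝ → ℝ × ℝ → ℝ}
    (h : IsRegularPair U Z) (t : ℝ) : IsStateField a fun x => Z (x, t) where
  aemeasurable := by
    have hm : Measurable fun y : ℝ × (ℝ × ℝ) => ((y.1, t), y.2) :=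
      (Measurable.prodMk _root_.measurable_fst measurable_const).prodMk _root_.measurable_snd
    exact (h.measurable_snd.comp hm).aemeasurable
  abs_le_one := ae_of_all _ fun x => ae_of_all _ fun ρ => h.abs_le_one _ ρ

theorem measurable_virgin : Measurable virgin :=
  Measurable.ite (measurableSet_le measurable_fst.neg measurable_snd) measurable_const
    measurable_const

theorem abs_virgin (ρ : ℝ × ℝ) : |virgin ρ| = 1 := by
  unfold virgin
  split_ifs <;> simp

theorem isStateField_virgin : IsStateField a fun _ => virgin where
  aemeasurable := (measurable_virgin.comp measurable_snd).aemeasurable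
  abs_le_one := ae_of_all _ fun _ => ae_of_all _ fun ρ => (abs_virgin ρ).le

theorem abs_relay_virgin (ρ : ℝ × ℝ) (u : ℝ → ℝ) (t : ℝ) : |relay ρ u (virgin ρ) t| = 1 := by
  unfold relay
  split_ifs
  · simp
  · simp
  · exact abs_virgin ρ

theorem IsL1Config.isStateField {T : ℝ} {L : ℝ≥0} (h : IsL1Config a T L z) :
    IsStateField a z where
  aemeasurable := by
    have := h.aemeasurable
    rwa [Measure.volume_eq_prod, ← Measure.prod_restrict, Measure.restrict_univ] at this
  abs_le_one := by
    filter_upwards [h.mem] with x hx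
    obtain ⟨u, -, hu⟩ := hx
    filter_upwards [hu.2] with ρ hρ
    rw [hρ, abs_relay_virgin]

theorem IsL1Config.integrable_configDist {T : ℝ} {L : ℝ≥0} (h : IsL1Config a T L z)
    (h' : IsL1Config a T L z') : Integrable fun x => configDist a (z x) (z' x) := by
  refine (h.integrable.add h'.integrable).mono'
    (h.isStateField.aestronglyMeasurable_configDist h'.isStateField) ?_
  filter_upwards [h.isStateField.ae_configDist_triangle isStateField_virgin h'.isStateField]
    with x hx
  rw [Real.norm_of_nonneg (configDist_nonneg _ _ _)]
  rwa [configDist_comm a virgin] at hx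

end StateField

/-! ### Time slices and contraction -/

/-- A property that holds almost everywhere in the strip holds almost everywhere on almost every
time slice. -/
theorem ae_slice {T : ℝ} {P : ℝ × ℝ → Prop} (h : ∀ᵐ p ∂volume.restrict (strip T), P p) :
    ∀ᵐ t : ℝ, t ∈ Ioo 0 T → ∀ᵐ x : ℝ, P (x, t) := by
  rw [← ae_restrict_iff' measurableSet_Ioo]
  rw [Measure.volume_eq_prod, ← Measure.prod_restrict, Measure.restrict_univ] at h
  have := (Measure.measurePreserving_swap (μ := volume.restrict (Ioo 0 T))
    (ν := (volume : Measure ℝ))).quasiMeasurePreserving.ae h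
  exact Measure.ae_ae_of_ae_prod this

theorem ae_forall_integrableOn_slice {U : ℝ × ℝ → ℝ} (hU : LocallyIntegrable U) (T : ℝ) :
    ∀ᵐ t : ℝ, t ∈ Ioo 0 T → ∀ R : ℝ, IntegrableOn (fun x => U (x, t)) (Icc (-R) R) := by
  rw [← ae_restrict_iff' measurableSet_Ioo]
  have : ∀ n : ℕ, ∀ᵐ t ∂volume.restrict (Ioo 0 T),
      IntegrableOn (fun x => U (x, t)) (Icc (-(n : ℝ)) n) := by
    intro n
    have h1 : IntegrableOn U (Icc (-(n : ℝ)) n ×ˢ Ioo 0 T) :=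
      (hU.integrableOn_isCompact (isCompact_Icc.prod isCompact_Icc)).mono_set
        (prod_mono le_rfl Ioo_subset_Icc_self)
    rw [IntegrableOn, Measure.volume_eq_prod, ← Measure.prod_restrict] at h1
    exact h1.prod_left_ae
  filter_upwards [ae_all_iff.2 this] with t ht R
  obtain ⟨n, hn⟩ := exists_nat_ge R
  exact (ht n).mono_set (Icc_subset_Icc (by linarith) hn)

instance neBot_nhdsGT_inf_ae : (𝓝[>] (0 : ℝ) ⊓ ae volume).NeBot := by
  rw [inf_neBot_iff]
  intro s hs s' hs'
  obtain ⟨u, hu, hus⟩ := mem_nhdsGT_iff_exists_Ioo_subset.1 hs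
  have hpos : volume (Ioo 0 u) ≠ 0 := by
    rw [Real.volume_Ioo]
    simpa using hu
  have : (Ioo 0 u ∩ s').Nonempty := by
    by_contra hempty
    refine hpos (measure_mono_null (fun x hx hx' => hempty ⟨x, hx, hx'⟩) (mem_ae_iff.1 hs'))
  exact this.mono (inter_subset_inter_left _ hus)

theorem eventually_nhdsGT_inf_ae {T : ℝ} (hT : 0 < T) {P : ℝ → Prop}
    (h : ∀ᵐ t : ℝ, t ∈ Ioo 0 T → P t) : ∀ᶠ t in 𝓝[>] (0 : ℝ) ⊓ ae volume, P t := by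
  have h1 : ∀ᶠ t in 𝓝[>] (0 : ℝ) ⊓ ae volume, t ∈ Ioo 0 T :=
    Eventually.filter_mono inf_le_left (Ioo_mem_nhdsGT hT)
  have h2 : ∀ᶠ t in 𝓝[>] (0 : ℝ) ⊓ ae volume, t ∈ Ioo 0 T → P t :=
    Eventually.filter_mono inf_le_right h
  filter_upwards [h1, h2] with t a b using b a

section Contraction

variable {a T : ℝ} {U₁ U₂ : ℝ × ℝ → ℝ} {Z₁ Z₂ : ℝ × ℝ → ℝ × ℝ → ℝ}
  {v₁ v₂ : ℝ → ℝ} {y₁ y₂ : ℝ → ℝ × ℝ → ℝ}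

/-- The quantity whose integral over the line is contracted: the `L¹` density of the distance of
two pairs of an input and a configuration. -/
noncomputable def pairDist (a : ℝ) (v v' : ℝ) (y y' : ℝ × ℝ → ℝ) : ℝ :=
  |v - v'| + configDist a y y'

theorem pairDist_nonneg (a : ℝ) (v v' : ℝ) (y y' : ℝ × ℝ → ℝ) : 0 ≤ pairDist a v v' y y' :=
  add_nonneg (abs_nonneg _) (configDist_nonneg _ _ _)

theorem IsStateField.integrableOn_pairDist (hy₁ : IsStateField a y₁) (hy₂ : IsStateField a y₂)
    {R : ℝ} (hv₁ : IntegrableOn v₁ (Icc (-R) R)) (hv₂ : IntegrableOn v₂ (Icc (-R) R)) :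
    IntegrableOn (fun x => pairDist a (v₁ x) (v₂ x) (y₁ x) (y₂ x)) (Icc (-R) R) :=
  (hv₁.sub hv₂).abs.add (hy₁.integrableOn_configDist hy₂ isCompact_Icc.measure_lt_top.ne)

/-- On a time slice, the mass inside the cutoff is at most the mass in a bounded interval. -/
theorem integral_coneCutoff_le {g : ℝ → ℝ} (hg0 : ∀ x, 0 ≤ g x) {R t : ℝ} (ht : 0 ≤ t)
    (hg : IntegrableOn g (Icc (-(R + 1)) (R + 1))) :
    Integrable (fun x => coneCutoff R (x, t) * g x) ∧
    ∫ x, coneCutoff R (x, t) * g x ≤ ∫ x in Icc (-(R + 1)) (R + 1), g x := by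
  have hm : Continuous fun x : ℝ => coneCutoff R (x, t) :=
    (contDiff_coneCutoff R).continuous.comp (continuous_id.prodMk continuous_const)
  have hz : ∀ x, x ∉ Icc (-(R + 1)) (R + 1) → coneCutoff R (x, t) * g x = 0 := by
    intro x hx
    rw [coneCutoff_eq_zero, zero_mul]
    exact fun h => hx ⟨by linarith [h.1], h.2⟩
  have hi : IntegrableOn (fun x => coneCutoff R (x, t) * g x) (Icc (-(R + 1)) (R + 1)) := by
    refine Integrable.mono hg (hm.aestronglyMeasurable.mul hg.aestronglyMeasurable) (ae_of_all _ fun x => ?_)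
    rw [norm_mul, Real.norm_of_nonneg (coneCutoff_nonneg R _)]
    exact mul_le_of_le_one_left (norm_nonneg _) (coneCutoff_le_one R _)
  refine ⟨(integrableOn_iff_integrable_of_support_subset fun x hx => ?_).1 hi, ?_⟩
  · by_contra h
    exact hx (hz x h)
  · rw [← setIntegral_eq_integral_of_forall_compl_eq_zero hz]
    exact integral_mono hi hg fun x => mul_le_of_le_one_left (hg0 x) (coneCutoff_le_one R _)

/-- A time slice whose mass inside all the cutoffs is bounded is integrable, with the same
bound. -/
theorem integrable_of_integral_coneCutoff_le {g : ℝ → ℝ} (hg0 : ∀ x, 0 ≤ g x) {t I : ℝ}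
    (ht : 0 ≤ t) (hg : ∀ R : ℝ, IntegrableOn g (Icc (-R) R))
    (h : ∀ n : ℕ, ∫ x, coneCutoff n (x, t) * g x ≤ I) : Integrable g ∧ ∫ x, g x ≤ I := by
  have hcov : AECover (volume : Measure ℝ) atTop fun n : ℕ => Icc (t - n) (n : ℝ) :=
    aecover_Icc (tendsto_atBot_add_const_left _ t
      (tendsto_neg_atBot_iff.2 tendsto_natCast_atTop_atTop)) tendsto_natCast_atTop_atTop
  have hgi : ∀ n : ℕ, IntegrableOn g (Icc (t - n) n) := fun n =>
    (hg n).mono_set (Icc_subset_Icc (by linarith) le_rfl)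
  have hle : ∀ n : ℕ, ∫ x in Icc (t - n) (n : ℝ), g x ≤ I := by
    intro n
    refine le_trans ?_ (h n)
    have hi := (integral_coneCutoff_le hg0 ht (hg (n + 1))).1
    refine le_trans (le_of_eq ?_) (setIntegral_le_integral (s := Icc (t - n) (n : ℝ)) hi
      (ae_of_all _ fun x => mul_nonneg (coneCutoff_nonneg _ _) (hg0 x)))
    refine setIntegral_congr_fun measurableSet_Icc fun x hx => ?_
    rw [coneCutoff_eq_one hx.2 hx.1, one_mul]
  have hint := hcov.integrable_of_integral_bounded_of_nonneg_ae I hgi (ae_of_all _ hg0)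
    (Eventually.of_forall hle)
  exact ⟨hint, le_of_tendsto' (hcov.integral_tendsto_of_countably_generated hint) hle⟩

/-- The mass inside a cutoff is bounded by the total initial mass. -/
theorem integral_coneCutoff_le_initial (hT : 0 < T) (hp₁ : IsRegularPair U₁ Z₁)
    (hp₂ : IsRegularPair U₂ Z₂) (hv₁ : Integrable v₁) (hv₂ : Integrable v₂)
    (hy₁ : IsStateField a y₁) (hy₂ : IsStateField a y₂)
    (hE₀ : Integrable fun x => pairDist a (v₁ x) (v₂ x) (y₁ x) (y₂ x)) {R : ℝ}
    (hi₁ : Tendsto (fun t : ℝ => ∫ x in Icc (-(R + 1)) (R + 1),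
      pairDist a (U₁ (x, t)) (v₁ x) (Z₁ (x, t)) (y₁ x)) (𝓝[>] 0 ⊓ ae volume) (𝓝 0))
    (hi₂ : Tendsto (fun t : ℝ => ∫ x in Icc (-(R + 1)) (R + 1),
      pairDist a (U₂ (x, t)) (v₂ x) (Z₂ (x, t)) (y₂ x)) (𝓝[>] 0 ⊓ ae volume) (𝓝 0))
    {D : Set ℝ} (hD : ∀ᵐ t, t ∈ D)
    (hmono : ∀ s ∈ D, ∀ t ∈ D, 0 < s → s < t → t < T →
      ∫ x, coneCutoff R (x, t) * pairDist a (U₁ (x, t)) (U₂ (x, t)) (Z₁ (x, t)) (Z₂ (x, t)) ≤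
      ∫ x, coneCutoff R (x, s) * pairDist a (U₁ (x, s)) (U₂ (x, s)) (Z₁ (x, s)) (Z₂ (x, s)))
    {t : ℝ} (htD : t ∈ D) (ht : t ∈ Ioo 0 T) :
    ∫ x, coneCutoff R (x, t) * pairDist a (U₁ (x, t)) (U₂ (x, t)) (Z₁ (x, t)) (Z₂ (x, t)) ≤
      ∫ x, pairDist a (v₁ x) (v₂ x) (y₁ x) (y₂ x) := by
  have hlim := (hi₁.add hi₂).const_add (∫ x, pairDist a (v₁ x) (v₂ x) (y₁ x) (y₂ x))
  rw [add_zero, add_zero] at hlim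
  -- compare with an earlier time `s` close to `0`, where the mass is nearly the initial one
  refine ge_of_tendsto hlim ?_
  have hD' : ∀ᶠ s in 𝓝[>] (0 : ℝ) ⊓ ae volume, s ∈ D := Eventually.filter_mono inf_le_right hD
  have ht' : ∀ᶠ s in 𝓝[>] (0 : ℝ) ⊓ ae volume, s ∈ Ioo 0 t :=
    Eventually.filter_mono inf_le_left (Ioo_mem_nhdsGT ht.1)
  filter_upwards [hD', ht',
    eventually_nhdsGT_inf_ae hT (ae_forall_integrableOn_slice hp₁.locallyIntegrable T),
    eventually_nhdsGT_inf_ae hT (ae_forall_integrableOn_slice hp₂.locallyIntegrable T)]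
    with s hsD hs hs₁ hs₂
  have hz₁ := hp₁.isStateField (a := a) s
  have hz₂ := hp₂.isStateField (a := a) s
  have i₁ := hz₁.integrableOn_pairDist hy₁ (hs₁ (R + 1)) hv₁.integrableOn
  have i₂ := hz₂.integrableOn_pairDist hy₂ (hs₂ (R + 1)) hv₂.integrableOn
  have i := hz₁.integrableOn_pairDist hz₂ (hs₁ (R + 1)) (hs₂ (R + 1))
  calc _ ≤ _ := hmono s hsD t htD hs.1 hs.2 ht.2
    _ ≤ ∫ x in Icc (-(R + 1)) (R + 1),
          pairDist a (U₁ (x, s)) (U₂ (x, s)) (Z₁ (x, s)) (Z₂ (x, s)) :=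
        (integral_coneCutoff_le (fun x => pairDist_nonneg _ _ _ _ _) hs.1.le i).2
    _ ≤ ∫ x in Icc (-(R + 1)) (R + 1), (pairDist a (v₁ x) (v₂ x) (y₁ x) (y₂ x) +
          (pairDist a (U₁ (x, s)) (v₁ x) (Z₁ (x, s)) (y₁ x) +
            pairDist a (U₂ (x, s)) (v₂ x) (Z₂ (x, s)) (y₂ x))) := by
        refine integral_mono_ae i (hE₀.integrableOn.add (i₁.add i₂)) (ae_restrict_of_ae ?_)
        filter_upwards [hz₁.ae_configDist_triangle hy₁ hz₂, hy₁.ae_configDist_triangle hy₂ hz₂]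
          with x h1 h2
        have h3 := abs_sub_le (U₁ (x, s)) (v₁ x) (U₂ (x, s))
        have h4 := abs_sub_le (v₁ x) (v₂ x) (U₂ (x, s))
        rw [abs_sub_comm (v₂ x)] at h4
        rw [configDist_comm a (y₂ x)] at h2
        simp only [pairDist]
        linarith
    _ = (∫ x in Icc (-(R + 1)) (R + 1), pairDist a (v₁ x) (v₂ x) (y₁ x) (y₂ x)) +
          ((∫ x in Icc (-(R + 1)) (R + 1), pairDist a (U₁ (x, s)) (v₁ x) (Z₁ (x, s)) (y₁ x)) +
            ∫ x in Icc (-(R + 1)) (R + 1), pairDist a (U₂ (x, s)) (v₂ x) (Z₂ (x, s)) (y₂ x)) :=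
        (integral_add hE₀.integrableOn (i₁.add i₂)).trans
          (congrArg _ (integral_add i₁ i₂))
    _ ≤ _ := add_le_add_left (setIntegral_le_integral hE₀
          (ae_of_all _ fun x => pairDist_nonneg _ _ _ _ _)) _

end Contraction

theorem IsEntropySolution.tendsto_initial {a T : ℝ} (hT : 0 < T) {u₀ : ℝ → ℝ}
    {z₀ : ℝ → ℝ × ℝ → ℝ}
    {u w : ℝ → ℝ → ℝ} {z : ℝ → ℝ → ℝ × ℝ → ℝ} (h : IsEntropySolution a T u₀ z₀ u w z)
    {U : ℝ × ℝ → ℝ} {Z : ℝ × ℝ → ℝ × ℝ → ℝ}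
    (hU : ∀ᵐ p : ℝ × ℝ ∂volume.restrict (strip T),
      U p = u p.1 p.2 ∧ Z p =ᵐ[volume.restrict (triangle a)] z p.1 p.2) (R : ℝ) :
    Tendsto (fun t : ℝ => ∫ x in Icc (-R) R,
      pairDist a (U (x, t)) (u₀ x) (Z (x, t)) (z₀ x)) (𝓝[>] 0 ⊓ ae volume) (𝓝 0) := by
  refine (h.initial R).congr' ?_
  filter_upwards [eventually_nhdsGT_inf_ae hT (ae_slice hU)] with t ht
  refine integral_congr_ae (ae_restrict_of_ae ?_)
  filter_upwards [ht] with x hx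
  simp only [pairDist]
  rw [hx.1, configDist_congr hx.2 (EventuallyEq.refl _ _)]

end Preisach

theorem mainTheorem3 (a T : ℝ) (ha : 0 < a) (hT : 0 < T) (L : ℝ≥0) (hL : 0 < L)
    (u₀₁ u₀₂ : ℝ → ℝ) (z₀₁ z₀₂ : ℝ → ℝ × ℝ → ℝ)
    (hu₀₁ : Preisach.IsL1BV u₀₁) (hu₀₂ : Preisach.IsL1BV u₀₂)
    (hz₀₁ : Preisach.IsL1Config a T L z₀₁) (hz₀₂ : Preisach.IsL1Config a T L z₀₂)
    (hz₀₁' : Preisach.IsBVConfig a T L z₀₁) (hz₀₂' : Preisach.IsBVConfig a T L z₀₂)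
    (u₁ w₁ u₂ w₂ : ℝ → ℝ → ℝ) (z₁ z₂ : ℝ → ℝ → ℝ × ℝ → ℝ)
    (h₁ : Preisach.IsEntropySolution a T u₀₁ z₀₁ u₁ w₁ z₁)
    (h₂ : Preisach.IsEntropySolution a T u₀₂ z₀₂ u₂ w₂ z₂) :
    (Integrable (fun x : ℝ => |u₀₁ x - u₀₂ x| + Preisach.configDist a (z₀₁ x) (z₀₂ x)) ∧
      ∀ᵐ t : ℝ ∂volume.restrict (Icc 0 T),
        Integrable (fun x : ℝ => |u₁ x t - u₂ x t| + Preisach.configDist a (z₁ x t) (z₂ x t)) ∧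
        ∫ x : ℝ, (|u₁ x t - u₂ x t| + Preisach.configDist a (z₁ x t) (z₂ x t)) ≤
          ∫ x : ℝ, (|u₀₁ x - u₀₂ x| + Preisach.configDist a (z₀₁ x) (z₀₂ x))) ∧
    ((∀ᵐ x : ℝ, u₀₁ x = u₀₂ x ∧
        ∀ᵐ ρ ∂volume.restrict (Preisach.triangle a), z₀₁ x ρ = z₀₂ x ρ) →
      ∀ᵐ p : ℝ × ℝ ∂volume.restrict (univ ×ˢ Ioo 0 T),
        u₁ p.1 p.2 = u₂ p.1 p.2 ∧ w₁ p.1 p.2 = w₂ p.1 p.2 ∧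
        ∀ᵐ ρ ∂volume.restrict (Preisach.triangle a), z₁ p.1 p.2 ρ = z₂ p.1 p.2 ρ) := by
  open Preisach in
  have hE₀ : Integrable fun x : ℝ => pairDist a (u₀₁ x) (u₀₂ x) (z₀₁ x) (z₀₂ x) :=
    (hu₀₁.1.sub hu₀₂.1).abs.add (hz₀₁.integrable_configDist hz₀₂)
  obtain ⟨U₁, Z₁, hp₁, hU₁⟩ := h₁.exists_regularPair
  obtain ⟨U₂, Z₂, hp₂, hU₂⟩ := h₂.exists_regularPair
  let E : ℝ × ℝ → ℝ := fun p => pairDist a (U₁ p) (U₂ p) (Z₁ p) (Z₂ p)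
  have hE0 : ∀ p, 0 ≤ E p := fun p => pairDist_nonneg _ _ _ _ _
  have hFE : ∀ p, |U₁ p - U₂ p| ≤ E p := fun p => le_add_of_nonneg_right (configDist_nonneg _ _ _)
  have hEm : Measurable E := measurable_snd.comp
    ((measurable_entropyField (a := a) hp₁ hp₂).comp (measurable_id.prodMk measurable_id))
  have hF : LocallyIntegrable fun p => |U₁ p - U₂ p| :=
    (hp₁.locallyIntegrable.sub hp₂.locallyIntegrable).mono
      (hp₁.measurable_fst.sub hp₂.measurable_fst).abs.aestronglyMeasurable
      (ae_of_all _ fun p => by simp)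
  have hE : LocallyIntegrable E := by
    refine (hF.add (locallyIntegrable_const (2 * volume.real (triangle a)))).mono
      hEm.aestronglyMeasurable (ae_of_all _ fun p => ?_)
    have hd := configDist_le (a := a) (ae_of_all _ (hp₁.abs_le_one p))
      (ae_of_all _ (hp₂.abs_le_one p))
    rw [Real.norm_of_nonneg (hE0 p)]
    refine le_trans ?_ (le_abs_self _)
    simp only [E, pairDist, Pi.add_apply]
    linarith
  -- Kružkov's inequality, and the decay of the mass inside the cutoffs
  choose D hD hmono using fun n : ℕ => ae_antitone_integral_coneCutoff (T := T) hF hE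
    (fun p => abs_nonneg _) hFE (fun ψ hψ => h₁.kruzkov h₂ hp₁ hp₂ hU₁ hU₂ hψ) (n : ℝ)
  have key : ∀ᵐ t : ℝ, t ∈ Ioo 0 T → Integrable (fun x => E (x, t)) ∧
      ∫ x, E (x, t) ≤ ∫ x, pairDist a (u₀₁ x) (u₀₂ x) (z₀₁ x) (z₀₂ x) := by
    filter_upwards [ae_all_iff.2 hD, ae_forall_integrableOn_slice hp₁.locallyIntegrable T,
      ae_forall_integrableOn_slice hp₂.locallyIntegrable T] with t htD ht₁ ht₂ ht
    refine integrable_of_integral_coneCutoff_le (fun x => hE0 _) ht.1.le (fun R =>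
      (hp₁.isStateField t).integrableOn_pairDist (hp₂.isStateField t) (ht₁ ht R) (ht₂ ht R))
      fun n => ?_
    exact integral_coneCutoff_le_initial hT hp₁ hp₂ hu₀₁.1 hu₀₂.1 hz₀₁.isStateField
      hz₀₂.isStateField hE₀ (h₁.tendsto_initial hT hU₁ _) (h₂.tendsto_initial hT hU₂ _)
      (hD n) (hmono n) (htD n) ht
  refine ⟨⟨hE₀, ?_⟩, fun heq => ?_⟩
  · rw [← Measure.restrict_congr_set Ioo_ae_eq_Icc, ae_restrict_iff' measurableSet_Ioo]
    filter_upwards [key, ae_slice hU₁, ae_slice hU₂] with t ht s₁ s₂ htT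
    have hcongr : (fun x => E (x, t)) =ᵐ[volume]
        fun x => |u₁ x t - u₂ x t| + configDist a (z₁ x t) (z₂ x t) := by
      filter_upwards [s₁ htT, s₂ htT] with x e₁ e₂
      simp only [E, pairDist]
      rw [e₁.1, e₂.1, configDist_congr e₁.2 e₂.2]
    obtain ⟨hi, hle⟩ := ht htT
    exact ⟨hi.congr hcongr, (integral_congr_ae hcongr).symm.trans_le hle⟩
  · have hI : ∫ x, pairDist a (u₀₁ x) (u₀₂ x) (z₀₁ x) (z₀₂ x) = 0 := by
      refine integral_eq_zero_of_ae ?_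
      filter_upwards [heq] with x hx
      simp only [pairDist]
      rw [hx.1, configDist_congr hx.2 (EventuallyEq.refl _ _)]
      simp [configDist]
    have hE1 : MeasurableSet {p | E p = 0} := hEm (measurableSet_singleton 0)
    have hzero : ∀ᵐ p : ℝ × ℝ ∂volume.restrict (strip T), E p = 0 := by
      rw [Measure.volume_eq_prod, ← Measure.prod_restrict, Measure.restrict_univ,
        Measure.ae_prod_iff_ae_ae hE1, Measure.ae_ae_comm (p := fun x t => E (x, t) = 0) hE1,
        ae_restrict_iff' measurableSet_Ioo]
      filter_upwards [key] with t ht htT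
      obtain ⟨hi, hle⟩ := ht htT
      rw [hI] at hle
      exact (integral_eq_zero_iff_of_nonneg (fun x => hE0 (x, t)) hi).1
        (le_antisymm hle (integral_nonneg fun x => hE0 (x, t)))
    filter_upwards [hzero, hU₁, hU₂, h₁.output, h₂.output] with p hp e₁ e₂ o₁ o₂
    have hc0 := configDist_nonneg a (Z₁ p) (Z₂ p)
    have hu : |U₁ p - U₂ p| = 0 := le_antisymm (hp ▸ hFE p) (abs_nonneg _)
    have hz : configDist a (Z₁ p) (Z₂ p) = 0 := by
      have : |U₁ p - U₂ p| + configDist a (Z₁ p) (Z₂ p) = 0 := hp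
      linarith
    have hzz : z₁ p.1 p.2 =ᵐ[volume.restrict (triangle a)] z₂ p.1 p.2 := by
      have h0 := (integral_eq_zero_iff_of_nonneg (fun ρ => abs_nonneg _)
        ((hp₁.integrable a p).sub (hp₂.integrable a p)).abs).1 hz
      filter_upwards [h0, e₁.2, e₂.2] with ρ hρ r₁ r₂
      rw [← r₁, ← r₂]
      exact sub_eq_zero.1 (abs_eq_zero.1 hρ)
    refine ⟨?_, ?_, hzz⟩
    · rw [← e₁.1, ← e₂.1]
      exact sub_eq_zero.1 (abs_eq_zero.1 hu)
    · rw [o₁, o₂]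
      exact integral_congr_ae hzz
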